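/- Let $n\ge 0$ and let $\hbar,\upsilon\in\mathbb R\setminus\{0\}$. For $N\ge 0$ the Heisenberg group $\mathbb H^N$ is $\{(s,x,y): s\in\mathbb R,\ x,y\in\mathbb R^N\}$ with $(s,x,y)(s',x',y')=(s+s'+\tfrac12\omega(x,y;x',y'),x+x',y+y')$, where $\omega(x,y;x',y')=xy'-x'y$. On functions on $\mathbb R^{2n}$ put $$[\Lambda_\hbar(s,x,y)f](x',y')=e^{\pi i\hbar(2s+xy'-yx')}f(x'-x,y'-y),\qquad [R_\hbar(s,x,y)f](x',y')=e^{\pi i\hbar(-2s+xy'-yx')}f(x'+x,y'+y),$$ for $(s,x,y)\in\mathbb H^n$, and let $\rho_\hbar$ be the Schrödinger representation of $\mathbb H^{2n}$, $[\rho_\hbar(s,x,y)f](t)=e^{\pi i\hbar(2s-2yt+xy)}f(t-x)$, $t\in\mathbb R^{2n}$. For $(s,x_1,x_2,y_1,y_2)\in\mathbb H^{2n}$ let $$\widetilde\Xi_\hbar(s,x_1,x_2,y_1,y_2)=\Lambda_\hbar(s,x_1,y_1)\,R_\hbar(0,\upsilon y_2,x_2/\upsilon).$$ For a kernel $k$ on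 $\mathbb R^{4n}$ the two-sided relative convolution is $$D(k)=\int_{\mathbb R^{4n}}k(x_1,y_1,x_2,y_2)\,\Lambda_\hbar(0,x_1,y_1)R_\hbar(0,x_2,y_2)\,dx_1\,dy_1\,dx_2\,dy_2$$ in the weak sense; it is a bounded operator on $L^2(\mathbb R^{2n})$ for $k\in L^1(\mathbb R^{4n})$, and a continuous operator $\mathcal S(\mathbb R^{2n})\to\mathcal S'(\mathbb R^{2n})$ for $k\in\mathcal S'(\mathbb R^{4n})$. For a symplectic form $\Omega$ on $\mathbb R^{4n}$ the symplectic Fourier transform is $\psi\mapsto(\hbar/2)^{2n}\int\psi(z')e^{\pi i\hbar\,\Omega(z',z)}\,dz'$, extended to $\mathcal S'$ by duality. Let $\wideparen a$ denote the transform of $a(x_1,x_2,y_1,y_2)$ for the form $x_1y_1'-x_1'y_1+x_2y_2'-x_2'y_2$ of $\mathbb H^{2n}$, and $\wideparen k$ the transform of a kernel $k(x_1,y_1,x_2,y_2)$ for the form $\omega(x_1,y_1;x_1',y_1')-\omega(x_2,y_2;x_2',y_2')$. The pseudodifferential operator on $\mathbb R^{2n}$ with Weyl symbol $a$ is the integrated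 representation $$a(D,X)=\int_{\mathbb R^{4n}}\wideparen a(x,y)\,\rho_\hbar(0,x,y)\,dx\,dy$$ in the weak sense, an operator $\mathcal S(\mathbb R^{2n})\to\mathcal S'(\mathbb R^{2n})$ for $a\in\mathcal S'(\mathbb R^{4n})$. **Theorem.** There is a unitary operator $U$ on $L^2(\mathbb R^{2n})$, depending only on $n,\hbar,\upsilon$, that restricts to a topological automorphism of $\mathcal S(\mathbb R^{2n})$ and extends to one of $\mathcal S'(\mathbb R^{2n})$ (with the topology of pointwise convergence), such that $$\rho_\hbar(g)=U\,\widetilde\Xi_\hbar(g)\,U^{-1}\quad\text{for all }g\in\mathbb H^{2n},$$ and such that for every $k\in\mathcal S'(\mathbb R^{4n})$, as operators $\mathcal S(\mathbb R^{2n})\to\mathcal S'(\mathbb R^{2n})$, $$U\,D(k)\,U^{-1}=a(D,X),\qquad a(x_1,x_2,y_1,y_2)=\wideparen k(x_1,y_1,\upsilon y_2,x_2/\upsilon).$$ If $k\in L^1(\mathbb R^{4n})$, the same holds with $D(k)$ the bounded operator on $L^2(\mathbb R^{2n})$ and $a$ the function given by the integral formula for $\wideparen k$. If moreover $k\in\mathcal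 S(\mathbb R^{4n})$, then for every $u\in\mathcal S(\mathbb R^{2n})$ and almost every $t\in\mathbb R^{2n}$ $$[U\,D(k)\,U^{-1}u](t)=\int_{\mathbb R^{2n}}\int_{\mathbb R^{2n}}a(t+r,\xi)\,e^{-\pi i\hbar\,\xi(t-r)}\,u(r)\,d\xi\,dr .$$ -/

import Mathlib

open MeasureTheory SchwartzMap
open scoped RealInnerProductSpace ENNReal FourierTransform

noncomputable section

namespace HeisConv

/-! ### Euclidean spaces, doubled spaces, symplectic forms -/

/-- `ℝⁿ` with its Euclidean structure. -/
abbrev R (n : ℕ) : Type := EuclideanSpace ℝ (Fin n)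

/-- `W × W` with the Euclidean norm.  Thus `Dbl (R n)` is `ℝ²ⁿ` and `Dbl (Dbl (R n))` is `ℝ⁴ⁿ`. -/
abbrev Dbl (W : Type*) : Type _ := WithLp 2 (W × W)

/-- The point `(x, y)` of `W × W`. -/
abbrev pt {W : Type*} (x y : W) : Dbl W := WithLp.toLp 2 (x, y)

theorem pt_fst {W : Type*} (x y : W) : (pt x y).fst = x := rfl

theorem pt_snd {W : Type*} (x y : W) : (pt x y).snd = y := rfl

section Generic

set_option linter.unusedSectionVars false

variable {W : Type*} [NormedAddCommGroup W] [InnerProductSpace ℝ W]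

/-- The symplectic form `ω(x, y; x', y') = x y' - x' y`. -/
def sympForm (z z' : Dbl W) : ℝ := ⟪z.fst, z'.snd⟫ - ⟪z'.fst, z.snd⟫

/-- The symplectic form `ω(x₁, y₁; x₁', y₁') - ω(x₂, y₂; x₂', y₂')` of the pairs of group elements
`(x₁, y₁)` (acting from the left) and `(x₂, y₂)` (acting from the right). -/
def sympFormTwo (p p' : Dbl (Dbl W)) : ℝ := sympForm p.fst p'.fst - sympForm p.snd p'.snd

/-! ### The Heisenberg group and its representations -/

/-- The Heisenberg group over `W`: `Heis (R n)` is `ℍⁿ` and `Heis (Dbl (R n))` is `ℍ²ⁿ`. -/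
@[ext]
structure Heis (W : Type*) where
  s : ℝ
  x : W
  y : W

namespace Heis

instance : Mul (Heis W) :=
  ⟨fun g h => ⟨g.s + h.s + (1 / 2) * sympForm (pt g.x g.y) (pt h.x h.y), g.x + h.x, g.y + h.y⟩⟩

instance : One (Heis W) := ⟨⟨0, 0, 0⟩⟩

instance : Inv (Heis W) := ⟨fun g => ⟨-g.s, -g.x, -g.y⟩⟩

theorem mul_def (g h : Heis W) :
    g * h = ⟨g.s + h.s + (1 / 2) * sympForm (pt g.x g.y) (pt h.x h.y), g.x + h.x, g.y + h.y⟩ := rfl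

theorem one_def : (1 : Heis W) = ⟨0, 0, 0⟩ := rfl

theorem inv_def (g : Heis W) : g⁻¹ = ⟨-g.s, -g.x, -g.y⟩ := rfl

instance : Group (Heis W) :=
  Group.ofLeftAxioms
    (by
      intro a b c
      ext
      · simp only [mul_def, sympForm, pt_fst, pt_snd, inner_add_left, inner_add_right]
        ring
      · simp only [mul_def, add_assoc]
      · simp only [mul_def, add_assoc])
    (by
      intro a
      ext <;> simp [mul_def, one_def, sympForm])
    (by
      intro a
      ext <;> simp [mul_def, one_def, inv_def, sympForm])

end Heis

/-- Lifting of a function on `W × W` to a covariant function on the Heisenberg group. -/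
def lift (ħ : ℝ) (f : Dbl W → ℂ) (g : Heis W) : ℂ :=
  Complex.exp (-2 * Real.pi * Complex.I * ħ * g.s) * f (pt g.x g.y)

/-- Pulling of a function on the Heisenberg group to `W × W`. -/
def pull (F : Heis W → ℂ) (z : Dbl W) : ℂ := F ⟨0, z.fst, z.snd⟩

/-- The pulled left action `Λ_ħ(g)` on functions. -/
def leftFun (ħ : ℝ) (g : Heis W) (f : Dbl W → ℂ) : Dbl W → ℂ :=
  pull fun g' => lift ħ f (g⁻¹ * g')

/-- The pulled right action `R_ħ(g)` on functions. -/
def rightFun (ħ : ℝ) (g : Heis W) (f : Dbl W → ℂ) : Dbl W → ℂ :=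
  pull fun g' => lift ħ f (g' * g)

/-- The Schrödinger representation `ρ_ħ(g)` on functions. -/
def schrodingerFun (ħ : ℝ) (g : Heis W) (f : W → ℂ) : W → ℂ := fun t =>
  Complex.exp ((Real.pi * ħ * (2 * g.s - 2 * ⟪g.y, t⟫ + ⟪g.x, g.y⟫) : ℝ) * Complex.I) * f (t - g.x)

theorem leftFun_apply (ħ : ℝ) (g : Heis W) (f : Dbl W → ℂ) (z : Dbl W) :
    leftFun ħ g f z =
      Complex.exp ((Real.pi * ħ * (2 * g.s + ⟪g.x, z.snd⟫ - ⟪g.y, z.fst⟫) : ℝ) * Complex.I) *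
        f (z - pt g.x g.y) := by
  have h : pt (-g.x + z.fst) (-g.y + z.snd) = z - pt g.x g.y := by
    apply WithLp.ofLp_injective
    ext <;> simp [sub_eq_neg_add]
  simp only [leftFun, pull, lift, Heis.mul_def, Heis.inv_def, h]
  congr 2
  rw [real_inner_comm z.fst g.y]
  simp only [sympForm, pt_fst, pt_snd, inner_neg_left, inner_neg_right]
  push_cast
  ring

theorem rightFun_apply (ħ : ℝ) (g : Heis W) (f : Dbl W → ℂ) (z : Dbl W) :
    rightFun ħ g f z =
      Complex.exp ((Real.pi * ħ * (-2 * g.s + ⟪g.x, z.snd⟫ - ⟪g.y, z.fst⟫) : ℝ) * Complex.I) *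
        f (z + pt g.x g.y) := by
  have h : pt (z.fst + g.x) (z.snd + g.y) = z + pt g.x g.y := by
    apply WithLp.ofLp_injective
    ext <;> simp
  simp only [rightFun, pull, lift, Heis.mul_def, h]
  congr 2
  rw [real_inner_comm z.fst g.y]
  simp only [sympForm, pt_fst, pt_snd]
  push_cast
  ring

variable [FiniteDimensional ℝ W] [MeasurableSpace W] [BorelSpace W]

/-- `L²(W)` with respect to Lebesgue measure. -/
abbrev L2 (W : Type*) [NormedAddCommGroup W] [InnerProductSpace ℝ W] [FiniteDimensional ℝ W]
    [MeasurableSpace W] [BorelSpace W] : Type _ := Lp ℂ 2 (volume : Measure W)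

theorem memLp_phaseShift {θ : W → ℝ} (hθ : Continuous θ) (a : W) (f : L2 W) :
    MemLp (fun t => Complex.exp (θ t * Complex.I) * f (t - a)) 2 volume := by
  have h1 : MemLp (fun t => f (t - a)) 2 volume :=
    (Lp.memLp f).comp_measurePreserving (measurePreserving_sub_right volume a)
  refine h1.of_le ?_ ?_
  · exact (by fun_prop : Continuous fun t => Complex.exp (θ t * Complex.I)).aestronglyMeasurable.mul
      h1.aestronglyMeasurable
  · refine Filter.Eventually.of_forall fun t => ?_
    simp [Complex.norm_exp_ofReal_mul_I]

/-- The unitary operator `f(t) ↦ exp(i θ(t)) f(t - a)` on `L²(W)`. -/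
def phaseShift (θ : W → ℝ) (hθ : Continuous θ) (a : W) : L2 W →L[ℂ] L2 W :=
  LinearMap.mkContinuous
    { toFun := fun f => (memLp_phaseShift hθ a f).toLp _
      map_add' := by
        intro f g
        rw [← MemLp.toLp_add]
        apply MemLp.toLp_congr
        have h := (measurePreserving_sub_right volume a).quasiMeasurePreserving.ae_eq_comp
          (Lp.coeFn_add f g)
        filter_upwards [h] with t ht
        simp only [Function.comp_apply, Pi.add_apply] at ht ⊢
        rw [ht]
        ring
      map_smul' := by
        intro c f
        rw [RingHom.id_apply, ← MemLp.toLp_const_smul]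
        apply MemLp.toLp_congr
        have h := (measurePreserving_sub_right volume a).quasiMeasurePreserving.ae_eq_comp
          (Lp.coeFn_smul c f)
        filter_upwards [h] with t ht
        simp only [Function.comp_apply, Pi.smul_apply, smul_eq_mul] at ht ⊢
        rw [ht]
        ring }
    1
    (by
      intro f
      rw [one_mul]
      have h1 : eLpNorm (fun t => Complex.exp (θ t * Complex.I) * f (t - a)) 2 volume =
          eLpNorm f 2 volume := by
        rw [← eLpNorm_comp_measurePreserving (Lp.aestronglyMeasurable f)
          (measurePreserving_sub_right volume a)]
        refine eLpNorm_congr_norm_ae (Filter.Eventually.of_forall fun t => ?_)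
        simp [Complex.norm_exp_ofReal_mul_I]
      refine le_of_eq ?_
      refine (Lp.norm_toLp _ (memLp_phaseShift hθ a f)).trans ?_
      rw [h1, Lp.norm_def])

theorem phaseShift_coeFn (θ : W → ℝ) (hθ : Continuous θ) (a : W) (f : L2 W) :
    phaseShift θ hθ a f =ᵐ[volume] fun t => Complex.exp (θ t * Complex.I) * f (t - a) :=
  MemLp.coeFn_toLp (memLp_phaseShift hθ a f)

/-- `Λ_ħ(g)` on `L²(W × W)`. -/
def left (ħ : ℝ) (g : Heis W) : L2 (Dbl W) →L[ℂ] L2 (Dbl W) :=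
  phaseShift (fun z => Real.pi * ħ * (2 * g.s + ⟪g.x, z.snd⟫ - ⟪g.y, z.fst⟫))
    (by
      have h1 : Continuous fun z : Dbl W => z.fst := (WithLp.fstL 2 ℝ W W).continuous
      have h2 : Continuous fun z : Dbl W => z.snd := (WithLp.sndL 2 ℝ W W).continuous
      fun_prop)
    (pt g.x g.y)

/-- `R_ħ(g)` on `L²(W × W)`. -/
def right (ħ : ℝ) (g : Heis W) : L2 (Dbl W) →L[ℂ] L2 (Dbl W) :=
  phaseShift (fun z => Real.pi * ħ * (-2 * g.s + ⟪g.x, z.snd⟫ - ⟪g.y, z.fst⟫))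
    (by
      have h1 : Continuous fun z : Dbl W => z.fst := (WithLp.fstL 2 ℝ W W).continuous
      have h2 : Continuous fun z : Dbl W => z.snd := (WithLp.sndL 2 ℝ W W).continuous
      fun_prop)
    (-pt g.x g.y)

/-- The Schrödinger representation `ρ_ħ(g)` on `L²(W)`. -/
def schrodinger (ħ : ℝ) (g : Heis W) : L2 W →L[ℂ] L2 W :=
  phaseShift (fun t => Real.pi * ħ * (2 * g.s - 2 * ⟪g.y, t⟫ + ⟪g.x, g.y⟫)) (by fun_prop) g.x

theorem left_coeFn (ħ : ℝ) (g : Heis W) (f : L2 (Dbl W)) :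
    left ħ g f =ᵐ[volume] leftFun ħ g f := by
  refine (phaseShift_coeFn _ _ _ f).trans (Filter.Eventually.of_forall fun z => ?_)
  rw [leftFun_apply]

theorem right_coeFn (ħ : ℝ) (g : Heis W) (f : L2 (Dbl W)) :
    right ħ g f =ᵐ[volume] rightFun ħ g f := by
  refine (phaseShift_coeFn _ _ _ f).trans (Filter.Eventually.of_forall fun z => ?_)
  simp only [rightFun_apply, sub_neg_eq_add]

theorem schrodinger_coeFn (ħ : ℝ) (g : Heis W) (f : L2 W) :
    schrodinger ħ g f =ᵐ[volume] schrodingerFun ħ g f :=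
  phaseShift_coeFn _ _ _ f

/-! ### Symplectic Fourier transforms -/

/-- The map `(x, y) ↦ c (y, -x)`. -/
def rotate (c : ℝ) (hc : c ≠ 0) : Dbl W ≃L[ℝ] Dbl W :=
  LinearEquiv.toContinuousLinearEquiv
    { toFun := fun z => pt (c • z.snd) (-(c • z.fst))
      invFun := fun z => pt (-(c⁻¹ • z.snd)) (c⁻¹ • z.fst)
      map_add' := fun z w => by
        apply WithLp.ofLp_injective
        ext <;> simp [add_comm]
      map_smul' := fun r z => by
        apply WithLp.ofLp_injective
        ext <;> simp [smul_comm c r]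
      left_inv := fun z => by
        apply WithLp.ofLp_injective
        ext <;> simp [smul_smul, hc]
      right_inv := fun z => by
        apply WithLp.ofLp_injective
        ext <;> simp [smul_smul, hc] }

/-- The map `(p₁, p₂) ↦ (rotate c p₁, rotate (-c) p₂)`. -/
def rotateTwo (c : ℝ) (hc : c ≠ 0) : Dbl (Dbl W) ≃L[ℝ] Dbl (Dbl W) :=
  LinearEquiv.toContinuousLinearEquiv
    { toFun := fun p => pt (rotate c hc p.fst) (rotate (-c) (neg_ne_zero.mpr hc) p.snd)
      invFun := fun p =>
        pt ((rotate c hc).symm p.fst) ((rotate (-c) (neg_ne_zero.mpr hc)).symm p.snd)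
      map_add' := fun z w => by
        apply WithLp.ofLp_injective
        simp
      map_smul' := fun r z => by
        apply WithLp.ofLp_injective
        simp
      left_inv := fun z => by
        apply WithLp.ofLp_injective
        ext1 <;> simp
      right_inv := fun z => by
        apply WithLp.ofLp_injective
        ext1 <;> simp }

/-- The Fourier transform of a function on the `2N`-dimensional space `E` with respect to the
symplectic form `Ω`:  `z ↦ (ħ/2)ᴺ ∫ ψ(z') exp(π i ħ Ω(z', z)) dz'`. -/
def fourierFun {E : Type*} [MeasureSpace E] (Ω : E → E → ℝ) (N : ℕ) (ħ : ℝ) (ψ : E → ℂ) (z : E) :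
    ℂ :=
  ((ħ / 2 : ℝ) : ℂ) ^ N * ∫ z', ψ z' * Complex.exp ((Real.pi * ħ * Ω z' z : ℝ) * Complex.I)

/-- `φ ↦ (ħ/2)ᴺ (𝓕 φ) ∘ J` on Schwartz functions. -/
def fourierAlong {E : Type*} [NormedAddCommGroup E] [InnerProductSpace ℝ E]
    [FiniteDimensional ℝ E] [MeasurableSpace E] [BorelSpace E] (J : E ≃L[ℝ] E) (N : ℕ) (ħ : ℝ) :
    𝓢(E, ℂ) →L[ℂ] 𝓢(E, ℂ) :=
  (((ħ / 2 : ℝ) : ℂ) ^ N) •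
    (compCLMOfContinuousLinearEquiv ℂ J ∘L FourierTransform.fourierCLM ℂ 𝓢(E, ℂ))

theorem fourierAlong_apply {E : Type*} [NormedAddCommGroup E] [InnerProductSpace ℝ E]
    [FiniteDimensional ℝ E] [MeasurableSpace E] [BorelSpace E] (J : E ≃L[ℝ] E) (N : ℕ) (ħ : ℝ)
    (φ : 𝓢(E, ℂ)) (z : E) :
    fourierAlong J N ħ φ z =
      ((ħ / 2 : ℝ) : ℂ) ^ N *
        ∫ z', φ z' * Complex.exp ((-2 * Real.pi * ⟪z', J z⟫ : ℝ) * Complex.I) := by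
  have h : fourierAlong J N ħ φ z = ((ħ / 2 : ℝ) : ℂ) ^ N * 𝓕 (φ : E → ℂ) (J z) := rfl
  rw [h, Real.fourier_eq']
  simp only [smul_eq_mul, mul_comm]

/-- The symplectic Fourier transform of tempered distributions on `W × W`, the transpose of
`φ ↦ (z' ↦ (ħ/2)ᴺ ∫ φ(z) exp(π i ħ ω(z', z)) dz)` with `N = dim W`. -/
def fourierDist (ħ : ℝ) (hħ : ħ ≠ 0) : 𝓢'(Dbl W, ℂ) →L[ℂ] 𝓢'(Dbl W, ℂ) :=
  PointwiseConvergenceCLM.precomp ℂ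
    (fourierAlong (rotate (ħ / 2) (div_ne_zero hħ two_ne_zero)) (Module.finrank ℝ W) ħ)

theorem fourierDist_apply (ħ : ℝ) (hħ : ħ ≠ 0) (T : 𝓢'(Dbl W, ℂ)) (φ ψ : 𝓢(Dbl W, ℂ))
    (h : ∀ z', ψ z' = ((ħ / 2 : ℝ) : ℂ) ^ Module.finrank ℝ W *
      ∫ z, φ z * Complex.exp ((Real.pi * ħ * sympForm z' z : ℝ) * Complex.I)) :
    fourierDist ħ hħ T φ = T ψ := by
  have : fourierAlong (rotate (ħ / 2) (div_ne_zero hħ two_ne_zero)) (Module.finrank ℝ W) ħ φ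
      = ψ := by
    ext z'
    rw [fourierAlong_apply, h]
    congr 2
    ext z
    congr 4
    simp only [rotate, sympForm, LinearEquiv.coe_toContinuousLinearEquiv', LinearEquiv.coe_mk,
      LinearMap.coe_mk, AddHom.coe_mk, WithLp.prod_inner_apply, inner_neg_right, inner_smul_right]
    simp only [WithLp.ofLp_fst, WithLp.ofLp_snd, real_inner_comm]
    ring
  rw [← this]
  rfl

/-- The symplectic Fourier transform of tempered distributions on `(W × W) × (W × W)` for the form
`sympFormTwo`, the transpose of `φ ↦ (p' ↦ (ħ/2)²ᴺ ∫ φ(p) exp(π i ħ Ω(p', p)) dp)` with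
`N = dim W`. -/
def fourierTwoDist (ħ : ℝ) (hħ : ħ ≠ 0) : 𝓢'(Dbl (Dbl W), ℂ) →L[ℂ] 𝓢'(Dbl (Dbl W), ℂ) :=
  PointwiseConvergenceCLM.precomp ℂ
    (fourierAlong (rotateTwo (ħ / 2) (div_ne_zero hħ two_ne_zero)) (2 * Module.finrank ℝ W) ħ)

theorem fourierTwoDist_apply (ħ : ℝ) (hħ : ħ ≠ 0) (T : 𝓢'(Dbl (Dbl W), ℂ))
    (φ ψ : 𝓢(Dbl (Dbl W), ℂ))
    (h : ∀ p', ψ p' = ((ħ / 2 : ℝ) : ℂ) ^ (2 * Module.finrank ℝ W) *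
      ∫ p, φ p * Complex.exp ((Real.pi * ħ * sympFormTwo p' p : ℝ) * Complex.I)) :
    fourierTwoDist ħ hħ T φ = T ψ := by
  have : fourierAlong (rotateTwo (ħ / 2) (div_ne_zero hħ two_ne_zero)) (2 * Module.finrank ℝ W) ħ φ
      = ψ := by
    ext z'
    rw [fourierAlong_apply, h]
    congr 2
    ext z
    congr 4
    simp only [rotate, rotateTwo, sympForm, sympFormTwo, LinearEquiv.coe_toContinuousLinearEquiv',
      LinearEquiv.coe_mk, LinearMap.coe_mk, AddHom.coe_mk, WithLp.prod_inner_apply,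
      inner_neg_right, inner_smul_right]
    simp only [WithLp.ofLp_fst, WithLp.ofLp_snd, real_inner_comm]
    ring
  rw [← this]
  rfl

/-! ### Integrated representations and Weyl pseudodifferential operators -/

/-- `T = ∫ k(x) π(x) dx`, the integral being understood in the weak sense. -/
def IsWeakIntegral {X H : Type*} [MeasureSpace X] [NormedAddCommGroup H] [InnerProductSpace ℂ H]
    (k : X → ℂ) (π : X → H →L[ℂ] H) (T : H →L[ℂ] H) : Prop :=
  ∀ f g : H, Integrable (fun x => k x * inner ℂ g (π x f)) ∧
    inner ℂ g (T f) = ∫ x, k x * inner ℂ g (π x f)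

/-- `A = ρ_ħ(b)`, the integrated Schrödinger representation with a distributional kernel `b`: for
Schwartz functions `u`, `v` the matrix coefficient `(x, y) ↦ ∫ (ρ_ħ(0, x, y) u)(t) v(t) dt` is a
Schwartz function, and `(A u)(v)` is the value of `b` on it. -/
def IsIntegratedSchrodinger (ħ : ℝ) (b : 𝓢'(Dbl W, ℂ)) (A : 𝓢(W, ℂ) →L[ℂ] 𝓢'(W, ℂ)) : Prop :=
  ∀ u v : 𝓢(W, ℂ), ∃ φ : 𝓢(Dbl W, ℂ),
    (∀ z, φ z = ∫ t, schrodingerFun ħ ⟨0, z.fst, z.snd⟩ u t * v t) ∧ A u v = b φ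

/-- `A` is the pseudodifferential operator `a(D, X)` with Weyl symbol `a`, that is the integrated
Schrödinger representation of the symplectic Fourier transform of `a`. -/
def IsWeylPDO (ħ : ℝ) (hħ : ħ ≠ 0) (a : 𝓢'(Dbl W, ℂ)) (A : 𝓢(W, ℂ) →L[ℂ] 𝓢'(W, ℂ)) : Prop :=
  IsIntegratedSchrodinger ħ (fourierDist ħ hħ a) A

/-! ### Two-sided relative convolutions -/

/-- `Λ_ħ(0, x₁, y₁) R_ħ(0, x₂, y₂)` on `L²(W × W)` at the point `((x₁, y₁), (x₂, y₂))`. -/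
def leftRight (ħ : ℝ) (p : Dbl (Dbl W)) : L2 (Dbl W) →L[ℂ] L2 (Dbl W) :=
  left ħ ⟨0, p.fst.fst, p.fst.snd⟩ ∘L right ħ ⟨0, p.snd.fst, p.snd.snd⟩

/-- The bounded two-sided convolution
`D(k) = ∫ k(x₁, y₁, x₂, y₂) Λ_ħ(0, x₁, y₁) R_ħ(0, x₂, y₂) dx₁ dy₁ dx₂ dy₂` on `L²(W × W)`. -/
def IsTwoSidedConv (ħ : ℝ) (k : Dbl (Dbl W) → ℂ) (D : L2 (Dbl W) →L[ℂ] L2 (Dbl W)) : Prop :=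
  IsWeakIntegral k (leftRight ħ) D

/-- The two-sided convolution `D(k)` with a distributional kernel `k`: for Schwartz functions
`u`, `v` the function
`(x₁, y₁, x₂, y₂) ↦ ∫ (Λ_ħ(0, x₁, y₁) R_ħ(0, x₂, y₂) u)(z) v(z) dz` is a Schwartz function, and
`(D u)(v)` is the value of `k` on it. -/
def IsTwoSidedConvDist (ħ : ℝ) (k : 𝓢'(Dbl (Dbl W), ℂ))
    (D : 𝓢(Dbl W, ℂ) →L[ℂ] 𝓢'(Dbl W, ℂ)) : Prop :=
  ∀ u v : 𝓢(Dbl W, ℂ), ∃ φ : 𝓢(Dbl (Dbl W), ℂ),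
    (∀ p, φ p = ∫ z, leftFun ħ ⟨0, p.fst.fst, p.fst.snd⟩
      (rightFun ħ ⟨0, p.snd.fst, p.snd.snd⟩ u) z * v z) ∧ D u v = k φ

/-- The representation
`(s, x₁, x₂, y₁, y₂) ↦ Λ_ħ(s, x₁, y₁) R_ħ(0, υ y₂, x₂ / υ)` of the doubled Heisenberg group. -/
def doubled (ħ υ : ℝ) (g : Heis (Dbl W)) : L2 (Dbl W) →L[ℂ] L2 (Dbl W) :=
  left ħ ⟨g.s, g.x.fst, g.y.fst⟩ ∘L right ħ ⟨0, υ • g.y.snd, υ⁻¹ • g.x.snd⟩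

/-- `B : ((x₁, x₂), (y₁, y₂)) ↦ ((x₁, y₁), (υ y₂, x₂ / υ))`. -/
def rearrange (υ : ℝ) (hυ : υ ≠ 0) : Dbl (Dbl W) ≃L[ℝ] Dbl (Dbl W) :=
  LinearEquiv.toContinuousLinearEquiv
    { toFun := fun q => pt (pt q.fst.fst q.snd.fst) (pt (υ • q.snd.snd) (υ⁻¹ • q.fst.snd))
      invFun := fun p => pt (pt p.fst.fst (υ • p.snd.snd)) (pt p.fst.snd (υ⁻¹ • p.snd.fst))
      map_add' := fun z w => by
        apply WithLp.ofLp_injective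
        ext1 <;> apply WithLp.ofLp_injective <;> ext <;> simp
      map_smul' := fun r z => by
        apply WithLp.ofLp_injective
        ext1 <;> apply WithLp.ofLp_injective <;> ext <;> simp [smul_comm _ r]
      left_inv := fun z => by
        apply WithLp.ofLp_injective
        ext1 <;> apply WithLp.ofLp_injective <;> ext <;> simp [smul_smul, hυ]
      right_inv := fun z => by
        apply WithLp.ofLp_injective
        ext1 <;> apply WithLp.ofLp_injective <;> ext <;> simp [smul_smul, hυ] }

/-- The symbol `a(x₁, x₂, y₁, y₂) = k̂(x₁, y₁, υ y₂, x₂ / υ)` of an integrable kernel `k`. -/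
def symbolFun (ħ υ : ℝ) (hυ : υ ≠ 0) (k : Dbl (Dbl W) → ℂ) (q : Dbl (Dbl W)) : ℂ :=
  fourierFun sympFormTwo (2 * Module.finrank ℝ W) ħ k (rearrange υ hυ q)

/-- The symbol `a = k̂ ∘ B` of a distributional kernel `k`, i.e. `a(φ) = k̂(φ ∘ B⁻¹)`
(the determinant of `B` is `±1`). -/
def symbolDist (ħ υ : ℝ) (hħ : ħ ≠ 0) (hυ : υ ≠ 0) (k : 𝓢'(Dbl (Dbl W), ℂ)) :
    𝓢'(Dbl (Dbl W), ℂ) :=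
  PointwiseConvergenceCLM.precomp ℂ (compCLMOfContinuousLinearEquiv ℂ (rearrange (W := W) υ hυ).symm)
    (fourierTwoDist ħ hħ k)

end Generic

end HeisConv

end

open MeasureTheory SchwartzMap HeisConv

noncomputable section

namespace HeisConv

/-! ### Tensor products and partial Fourier transforms of Schwartz functions -/

section Tensor

variable {E F : Type} [NormedAddCommGroup E] [NormedSpace ℝ E] [NormedAddCommGroup F]
  [NormedSpace ℝ F]

/-! Left and right translations commute and have opposite central characters. Exchanging $x_2$ and
$y_2$ in the right factor reverses the sign of its symplectic form, so the two-sided action becomes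
a representation of $\mathbb H^{2n}$ with the same central character as $\rho_\hbar$. Stone–von
Neumann then predicts $U$. Here $U$ is explicit: chirp, Fourier transform, linear substitution,
chirp, that is an integral operator with kernel $c\,e^{\pi i\hbar q(z,t)}$, $q=z_1z_2+\frac2\upsilon
z_1t_2-2z_2t_1-\frac2\upsilon t_1t_2$. Each factor preserves $\mathcal S$, Plancherel gives
unitarity, and the transpose has the same shape, which gives the extension to $\mathcal S'$. After a
translation of $z$, the intertwining relation is an identity between quadratic phases
(`intertwinerSchwartz_doubledSchwartz`).

Given $U$, the operators correspond because their matrix coefficients do. Pairing $D(k)u$ with $v$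
evaluates $k$ on a coefficient of the two-sided action, which is a Schrödinger coefficient composed
with $B^{-1}$, where $B$ is `rearrange`. So $U D(k)U^{-1}$ is the integrated representation of
$k\circ B$. As $B$ preserves Lebesgue measure and carries one symplectic form to the other, it
commutes with the symplectic Fourier transforms; these are involutive, so the Weyl symbol is
$\wideparen k\circ B$ (`symbolDist_fourierAlong`).

For distributional $k$, the coefficients must be Schwartz functions depending continuously on $u$
and on $v$ separately. A coefficient is a chirp times a partial Fourier transform of a sheared
tensor product, hence the need for continuity of `tensorCLM` and `partialFourier`. For $k\in L^1$,
pairing with Schwartz functions reduces the claim to the distributional one. For $k\in\mathcal S$,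
Fubini and Fourier inversion in $\xi$ produce the stated kernel. -/

theorem norm_iteratedFDeriv_comp_le_of_norm_le_one {E' E G : Type*} [NormedAddCommGroup E']
    [NormedSpace ℝ E'] [NormedAddCommGroup E] [NormedSpace ℝ E] [NormedAddCommGroup G]
    [NormedSpace ℝ G] {f : E → G} (hf : ContDiff ℝ (⊤ : ℕ∞) f) (L : E' →L[ℝ] E) (hL : ‖L‖ ≤ 1)
    (n : ℕ) (z : E') :
    ‖iteratedFDeriv ℝ n (fun z => f (L z)) z‖ ≤ ‖iteratedFDeriv ℝ n f (L z)‖ := by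
  have h := L.iteratedFDeriv_comp_right (n := ((⊤ : ℕ∞) : WithTop ℕ∞)) hf z (i := n)
    (by exact_mod_cast le_top)
  change ‖iteratedFDeriv ℝ n (f ∘ L) z‖ ≤ _
  rw [h]
  refine (ContinuousMultilinearMap.norm_compContinuousLinearMap_le _ _).trans ?_
  refine mul_le_of_le_one_right (norm_nonneg _) ?_
  simp only [Finset.prod_const]
  exact pow_le_one₀ (norm_nonneg _) hL

/-- Leibniz rule, with the weight split by $\|p\|\le(1+\|p_1\|)(1+\|p_2\|)$. The binomial
coefficients sum to $2^n$, and each factor $2^k$ comes from `one_add_le_sup_seminorm_apply`. The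
bound is linear in a seminorm of $u$, as `mkCLM` requires. -/
theorem norm_pow_mul_iteratedFDeriv_tensor_le (u : 𝓢(E, ℂ)) (v : 𝓢(F, ℂ)) (k n : ℕ) (p : E × F) :
    ‖p‖ ^ k * ‖iteratedFDeriv ℝ n (fun p : E × F => u p.1 * v p.2) p‖ ≤
      2 ^ n * (2 ^ k * ((Finset.Iic (k, n)).sup (schwartzSeminormFamily ℂ F ℂ)) v) * 2 ^ k *
        ((Finset.Iic (k, n)).sup (schwartzSeminormFamily ℂ E ℂ)) u := by
  set Su := ((Finset.Iic (k, n)).sup (schwartzSeminormFamily ℂ E ℂ)) u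
  set Sv := ((Finset.Iic (k, n)).sup (schwartzSeminormFamily ℂ F ℂ)) v
  have hu : ContDiff ℝ (⊤ : ℕ∞) (fun p : E × F => u p.1) := (u.smooth ⊤).comp contDiff_fst
  have hv : ContDiff ℝ (⊤ : ℕ∞) (fun p : E × F => v p.2) := (v.smooth ⊤).comp contDiff_snd
  have hp : ‖p‖ ^ k ≤ (1 + ‖p.1‖) ^ k * (1 + ‖p.2‖) ^ k := by
    rw [← mul_pow]
    gcongr
    rw [Prod.norm_def]
    have := norm_nonneg p.1
    have := norm_nonneg p.2
    apply max_le <;> nlinarith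
  have hsum := norm_iteratedFDeriv_mul_le (n := n) (N := ((⊤ : ℕ∞) : WithTop ℕ∞)) hu hv p
    (by exact_mod_cast le_top)
  have hterm : ∀ i ∈ Finset.range (n + 1),
      ‖p‖ ^ k * ((n.choose i : ℝ) * ‖iteratedFDeriv ℝ i (fun p : E × F => u p.1) p‖ *
        ‖iteratedFDeriv ℝ (n - i) (fun p : E × F => v p.2) p‖) ≤
      n.choose i * ((2 ^ k * Su) * (2 ^ k * Sv)) := by
    intro i hi
    have hi' : i ≤ n := Nat.lt_succ_iff.mp (Finset.mem_range.mp hi)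
    have h1 : (1 + ‖p.1‖) ^ k * ‖iteratedFDeriv ℝ i (fun p : E × F => u p.1) p‖ ≤ 2 ^ k * Su :=
      (mul_le_mul_of_nonneg_left (norm_iteratedFDeriv_comp_le_of_norm_le_one (u.smooth ⊤)
        (ContinuousLinearMap.fst ℝ E F) (ContinuousLinearMap.norm_fst_le _ _ _) i p)
        (by positivity)).trans
      (one_add_le_sup_seminorm_apply (m := (k, n)) le_rfl hi' u p.1)
    have h2 : (1 + ‖p.2‖) ^ k * ‖iteratedFDeriv ℝ (n - i) (fun p : E × F => v p.2) p‖ ≤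
        2 ^ k * Sv :=
      (mul_le_mul_of_nonneg_left (norm_iteratedFDeriv_comp_le_of_norm_le_one (v.smooth ⊤)
        (ContinuousLinearMap.snd ℝ E F) (ContinuousLinearMap.norm_snd_le _ _ _) (n - i) p)
        (by positivity)).trans
      (one_add_le_sup_seminorm_apply (m := (k, n)) le_rfl (Nat.sub_le n i) v p.2)
    have h3 := mul_le_mul h1 h2 (by positivity) ((by positivity : (0 : ℝ) ≤ _).trans h1)
    calc _ ≤ ((1 + ‖p.1‖) ^ k * (1 + ‖p.2‖) ^ k) * ((n.choose i : ℝ) *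
          ‖iteratedFDeriv ℝ i (fun p : E × F => u p.1) p‖ *
        ‖iteratedFDeriv ℝ (n - i) (fun p : E × F => v p.2) p‖) := by gcongr
      _ = n.choose i * (((1 + ‖p.1‖) ^ k * ‖iteratedFDeriv ℝ i (fun p : E × F => u p.1) p‖) *
        ((1 + ‖p.2‖) ^ k * ‖iteratedFDeriv ℝ (n - i) (fun p : E × F => v p.2) p‖)) := by ring
      _ ≤ _ := by gcongr
  calc _ ≤ ‖p‖ ^ k * ∑ i ∈ Finset.range (n + 1),
        (n.choose i : ℝ) * ‖iteratedFDeriv ℝ i (fun p : E × F => u p.1) p‖ *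
        ‖iteratedFDeriv ℝ (n - i) (fun p : E × F => v p.2) p‖ := by gcongr
    _ ≤ ∑ i ∈ Finset.range (n + 1), n.choose i * ((2 ^ k * Su) * (2 ^ k * Sv)) := by
      rw [Finset.mul_sum]
      exact Finset.sum_le_sum hterm
    _ = _ := by
      rw [← Finset.sum_mul]
      have := Nat.sum_range_choose n
      have h' : (∑ i ∈ Finset.range (n + 1), (n.choose i : ℝ)) = 2 ^ n := by exact_mod_cast this
      rw [h']
      ring

/-- `u ↦ ((x, t) ↦ u(x) v(t))` on Schwartz functions. -/
def tensorCLM (v : 𝓢(F, ℂ)) : 𝓢(E, ℂ) →L[ℂ] 𝓢(E × F, ℂ) :=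
  mkCLM (fun u p => u p.1 * v p.2) (fun u u' p => by simp [add_mul])
    (fun a u p => by simp [mul_assoc])
    (fun u => ((u.smooth ⊤).comp contDiff_fst).mul ((v.smooth ⊤).comp contDiff_snd))
    (fun m => ⟨Finset.Iic m,
      2 ^ m.2 * (2 ^ m.1 * ((Finset.Iic m).sup (schwartzSeminormFamily ℂ F ℂ)) v) * 2 ^ m.1,
      by positivity, fun u p => norm_pow_mul_iteratedFDeriv_tensor_le u v m.1 m.2 p⟩)

theorem tensorCLM_apply (v : 𝓢(F, ℂ)) (u : 𝓢(E, ℂ)) (p : E × F) :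
    tensorCLM v u p = u p.1 * v p.2 := rfl

end Tensor

/-! ### The partial Fourier transform and its continuity on Schwartz space -/

section PartialFourier

set_option linter.unusedSectionVars false

variable {E F : Type} [NormedAddCommGroup E] [NormedSpace ℝ E] [NormedAddCommGroup F]
  [InnerProductSpace ℝ F] [FiniteDimensional ℝ F] [MeasurableSpace F] [BorelSpace F]

section Slice

variable {G : Type} [NormedAddCommGroup G] [NormedSpace ℂ G]

/-- The restriction of a Schwartz function on `E × F` to `{x} × F`. -/
def slice (x : E) : 𝓢(E × F, G) →L[ℂ] 𝓢(F, G) :=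
  compCLM ℂ (g := fun t : F => (x, t))
    (by
      have h : (fun t : F => (x, t)) =
          (fun _ : F => ((x, 0) : E × F)) + (⇑(ContinuousLinearMap.inr ℝ E F)) := by
        ext t <;> simp
      rw [h]
      exact (Function.HasTemperateGrowth.const _).add
        (ContinuousLinearMap.inr ℝ E F).hasTemperateGrowth)
    ⟨1, 1, fun t => by
      have : ‖t‖ ≤ ‖((x, t) : E × F)‖ := norm_snd_le (x, t)
      linarith⟩

theorem slice_apply (x : E) (g : 𝓢(E × F, G)) (t : F) : slice x g t = g (x, t) := rfl

/-- Decay in the frozen variable is paid for by a higher weight on the product, since both $\|x\|$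
and $\|t\|$ are at most $\|(x,t)\|$. -/
theorem norm_pow_mul_seminorm_slice_le (l k n : ℕ) (x : E) (g : 𝓢(E × F, G)) :
    ‖x‖ ^ l * SchwartzMap.seminorm ℂ k n (slice x g) ≤ SchwartzMap.seminorm ℂ (k + l) n g := by
  rcases eq_or_ne (‖x‖ ^ l) 0 with h0 | h0
  · rw [h0, zero_mul]
    exact apply_nonneg _ _
  have hpos : 0 < ‖x‖ ^ l := lt_of_le_of_ne (by positivity) h0.symm
  rw [← le_div_iff₀' hpos]
  refine seminorm_le_bound ℂ k n _ (by positivity) fun t => ?_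
  rw [le_div_iff₀' hpos]
  have hg : ContDiff ℝ (⊤ : ℕ∞) (fun z : E × F => g ((x, 0) + z)) :=
    (g.smooth ⊤).comp (contDiff_const.add contDiff_id)
  have h1 : ‖iteratedFDeriv ℝ n (slice x g) t‖ ≤ ‖iteratedFDeriv ℝ n g (x, t)‖ := by
    have h := norm_iteratedFDeriv_comp_le_of_norm_le_one hg (ContinuousLinearMap.inr ℝ E F)
      (ContinuousLinearMap.norm_inr_le_one ℝ E F) n t
    rw [iteratedFDeriv_comp_add_left] at h
    simp only [ContinuousLinearMap.inr_apply, Prod.mk_add_mk, add_zero, zero_add] at h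
    exact h
  have hx : ‖x‖ ≤ ‖((x, t) : E × F)‖ := norm_fst_le (x, t)
  have ht : ‖t‖ ≤ ‖((x, t) : E × F)‖ := norm_snd_le (x, t)
  calc ‖x‖ ^ l * (‖t‖ ^ k * ‖iteratedFDeriv ℝ n (slice x g) t‖)
      ≤ ‖((x, t) : E × F)‖ ^ l * (‖((x, t) : E × F)‖ ^ k * ‖iteratedFDeriv ℝ n g (x, t)‖) := by
        gcongr
    _ = ‖((x, t) : E × F)‖ ^ (k + l) * ‖iteratedFDeriv ℝ n g (x, t)‖ := by ring
    _ ≤ _ := le_seminorm ℂ (k + l) n g (x, t)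

/-- The bound is uniform in $x$: this is the domination needed to differentiate under the integral.
-/
theorem exists_integrable_bound (g : 𝓢(E × F, G)) :
    ∃ b : F → ℝ, Integrable b ∧ ∀ x t, ‖g (x, t)‖ ≤ b t := by
  set N := Measure.integrablePower (volume : Measure F)
  set M := 2 ^ N * ((Finset.Iic (N, 0)).sup
    (fun m : ℕ × ℕ => SchwartzMap.seminorm ℂ m.1 m.2 (E := E × F) (F := G))) g
  refine ⟨fun t => M * (1 + ‖t‖) ^ (-(N : ℝ)),
    (Measure.integrable_pow_neg_integrablePower volume).const_mul M, fun x t => ?_⟩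
  have h := one_add_le_sup_seminorm_apply (𝕜 := ℂ) (m := (N, 0)) (k := N) (n := 0) le_rfl le_rfl
    g (x, t)
  rw [norm_iteratedFDeriv_zero] at h
  have ht : ‖t‖ ≤ ‖((x, t) : E × F)‖ := norm_snd_le (x, t)
  have h' : (1 + ‖t‖) ^ N * ‖g (x, t)‖ ≤ M := le_trans (by gcongr) h
  beta_reduce
  rw [Real.rpow_neg (by positivity), Real.rpow_natCast, ← div_eq_mul_inv, le_div_iff₀' (by positivity)]
  exact h'

/-- The partial Fourier transform in the second variable, as a function. -/
def partialFourierFun (g : 𝓢(E × F, G)) (p : E × F) : G := 𝓕 (slice p.1 g) p.2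

theorem partialFourierFun_eq (g : 𝓢(E × F, G)) (p : E × F) :
    partialFourierFun g p = ∫ t, Real.fourierChar (-⟪t, p.2⟫) • g (p.1, t) := by
  rw [partialFourierFun, fourier_coe, Real.fourier_eq]
  rfl

/-- Continuity of the Fourier transform on $\mathcal S(F)$ controls each slice by finitely many
seminorms of that slice, and these absorb the power of $\|x\|$ by `norm_pow_mul_seminorm_slice_le`.
-/
theorem exists_seminorm_bound_partialFourierFun (l k : ℕ) :
    ∃ q : Seminorm ℂ 𝓢(E × F, G), Continuous q ∧
      ∀ (g : 𝓢(E × F, G)) (p : E × F), ‖p.1‖ ^ l * (‖p.2‖ ^ k * ‖partialFourierFun g p‖) ≤ q g := by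
  let q₀ : Seminorm ℂ 𝓢(F, G) := (SchwartzMap.seminorm ℂ k 0).comp
    (FourierTransform.fourierCLM ℂ 𝓢(F, G)).toLinearMap
  have hq₀ : Continuous q₀ :=
    ((schwartz_withSeminorms ℂ F G).continuous_seminorm (k, 0)).comp
      (FourierTransform.fourierCLM ℂ 𝓢(F, G)).continuous
  obtain ⟨s, C, -, hC⟩ := Seminorm.bound_of_continuous (schwartz_withSeminorms ℂ F G) q₀ hq₀
  refine ⟨C • ∑ i ∈ s, SchwartzMap.seminorm ℂ (i.1 + l) i.2, ?_, fun g p => ?_⟩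
  · have : Continuous fun g : 𝓢(E × F, G) =>
        (C : ℝ) * ∑ i ∈ s, SchwartzMap.seminorm ℂ (i.1 + l) i.2 g := by
      refine continuous_const.mul (continuous_finsetSum _ fun i _ => ?_)
      exact (schwartz_withSeminorms ℂ (E × F) G).continuous_seminorm (i.1 + l, i.2)
    convert this using 2 with g
    simp [NNReal.smul_def]
  · have h1 : ‖p.2‖ ^ k * ‖partialFourierFun g p‖ ≤ q₀ (slice p.1 g) :=
      norm_pow_mul_le_seminorm ℂ (𝓕 (slice p.1 g)) k p.2
    have h2 : q₀ (slice p.1 g) ≤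
        C * ∑ i ∈ s, SchwartzMap.seminorm ℂ i.1 i.2 (slice p.1 g) := by
      refine (hC (slice p.1 g)).trans ?_
      have := Seminorm.finset_sup_le_sum (schwartzSeminormFamily ℂ F G) s (slice p.1 g)
      simp only [smul_apply, NNReal.smul_def, smul_eq_mul]
      gcongr
      refine this.trans (le_of_eq ?_)
      rw [sum_apply]
      rfl
    calc _ ≤ ‖p.1‖ ^ l * (C * ∑ i ∈ s, SchwartzMap.seminorm ℂ i.1 i.2 (slice p.1 g)) := by
          exact mul_le_mul_of_nonneg_left (h1.trans h2) (by positivity)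
      _ = C * ∑ i ∈ s, ‖p.1‖ ^ l * SchwartzMap.seminorm ℂ i.1 i.2 (slice p.1 g) := by
          rw [Finset.mul_sum, Finset.mul_sum, Finset.mul_sum]
          refine Finset.sum_congr rfl fun i _ => by ring
      _ ≤ C * ∑ i ∈ s, SchwartzMap.seminorm ℂ (i.1 + l) i.2 g := by
          gcongr with i _
          exact norm_pow_mul_seminorm_slice_le l i.1 i.2 p.1 g
      _ = _ := by simp [NNReal.smul_def]

/-- Precomposition with a real linear map, as a complex linear map. -/
def precompComplex {P Q : Type} [NormedAddCommGroup P] [NormedSpace ℝ P] [NormedAddCommGroup Q]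
    [NormedSpace ℝ Q] (A : P →L[ℝ] Q) : (Q →L[ℝ] G) →L[ℂ] (P →L[ℝ] G) :=
  LinearMap.mkContinuous
    { toFun := fun f => f ∘L A
      map_add' := fun f g => by ext; simp
      map_smul' := fun c f => by ext; simp } ‖A‖
    (fun f => by
      rw [mul_comm]
      exact f.opNorm_comp_le A)

variable (E F) in
/-- The bilinear map `(t, (x, y)) ↦ ⟪t, y⟫`. -/
def innerSnd : F →L[ℝ] (E × F) →L[ℝ] ℝ :=
  ((ContinuousLinearMap.compL ℝ (E × F) F ℝ).flip (ContinuousLinearMap.snd ℝ E F)) ∘L (innerSL ℝ)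

theorem innerSnd_apply (t : F) (p : E × F) : innerSnd E F t p = ⟪t, p.2⟫ := rfl

/-- The operator whose partial Fourier transform is the derivative of the partial Fourier
transform. -/
def partialFourierDeriv : 𝓢(E × F, G) →L[ℂ]
    @SchwartzMap (E × F) ((E × F) →L[ℝ] G) _ _ _ NormedSpace.complexToReal :=
  -(2 * Real.pi * Complex.I) •
      smulRightCLM ℂ G (innerSnd E F ∘L ContinuousLinearMap.snd ℝ E F) +
    postcompCLM (precompComplex
        (ContinuousLinearMap.inl ℝ E F ∘L ContinuousLinearMap.fst ℝ E F)) ∘L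
      fderivCLM ℂ (E × F) G

/-- Differentiation under the integral. The frequency variable meets only the character and brings
down $-2\pi i\langle t,\cdot\rangle$; the parameter meets only $g$ and gives its derivative along
$E$. Both terms are again Schwartz, so the derivative is a partial Fourier transform and the
argument can be iterated. -/
theorem hasFDerivAt_partialFourierFun (g : 𝓢(E × F, G)) (p : E × F) :
    HasFDerivAt (partialFourierFun g) (partialFourierFun (partialFourierDeriv g) p) p := by
  have hfun : partialFourierFun g = fun p : E × F =>
      ∫ t, Real.fourierChar (-⟪t, p.2⟫) • g (p.1, t) := funext (partialFourierFun_eq g)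
  rw [hfun, partialFourierFun_eq]
  obtain ⟨b, hb, hbound⟩ := exists_integrable_bound (partialFourierDeriv g)
  have hnorm : ∀ {G' : Type} [NormedAddCommGroup G'] [NormedSpace ℂ G'] (c : Circle) (a : G'),
      ‖c • a‖ = ‖a‖ := fun c a => Circle.norm_smul c a
  have hcont : ∀ {G' : Type} [NormedAddCommGroup G'] [NormedSpace ℂ G'] (h : 𝓢(E × F, G'))
      (p : E × F),
      AEStronglyMeasurable (fun t => Real.fourierChar (-⟪t, p.2⟫) • h (p.1, t)) volume := by
    intro G' _ _ h p
    have h1 : Continuous fun t => Real.fourierChar (-⟪t, p.2⟫) :=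
      Real.continuous_fourierChar.comp (by fun_prop)
    have h2 : Continuous fun t => h (p.1, t) := h.continuous.comp (by fun_prop)
    exact (h1.smul h2).aestronglyMeasurable
  refine hasFDerivAt_integral_of_dominated_of_fderiv_le (𝕜 := ℝ)
    (F := fun (p : E × F) t => Real.fourierChar (-⟪t, p.2⟫) • g (p.1, t))
    (F' := fun p t => Real.fourierChar (-⟪t, p.2⟫) •
      (partialFourierDeriv g (p.1, t) : (E × F) →L[ℝ] G)) (s := Set.univ) (bound := b)
    Filter.univ_mem ?_ ?_ ?_ ?_ hb ?_
  · exact Filter.Eventually.of_forall fun p => (hcont g p)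
  · refine ((slice p.1 g).integrable (μ := volume)).mono (hcont g p)
      (Filter.Eventually.of_forall fun t => ?_)
    rw [Circle.norm_smul, slice_apply]
  · exact hcont (G' := (E × F) →L[ℝ] G) (partialFourierDeriv g) p
  · refine Filter.Eventually.of_forall fun t p _ => ?_
    exact (hnorm (G' := (E × F) →L[ℝ] G) _ _).trans_le (hbound p.1 t)
  · refine Filter.Eventually.of_forall fun t p _ => ?_
    have h1 := Real.hasFDerivAt_fourierChar_neg_bilinear_right (innerSnd E F) t p
    have h2 : HasFDerivAt (fun p : E × F => g (p.1, t))
        (fderiv ℝ g (p.1, t) ∘L (ContinuousLinearMap.inl ℝ E F ∘L ContinuousLinearMap.fst ℝ E F))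
        p := by
      have hi : HasFDerivAt (fun p : E × F => (p.1, t))
          (ContinuousLinearMap.inl ℝ E F ∘L ContinuousLinearMap.fst ℝ E F) p := by
        have h := (hasFDerivAt_fst (𝕜 := ℝ) (p := p)).prodMk (hasFDerivAt_const (𝕜 := ℝ) t p)
        exact h.congr_fderiv (by ext <;> simp)
      exact HasFDerivAt.comp p (g.hasFDerivAt (p.1, t)) hi
    have h3 := h1.smul h2
    simp only [innerSnd_apply] at h3
    refine h3.congr_fderiv ?_
    refine ContinuousLinearMap.ext fun z => ?_
    have hs : (⟪t, z.2⟫ : ℝ) • g (p.1, t) = ((⟪t, z.2⟫ : ℝ) : ℂ) • g (p.1, t) :=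
      (Complex.coe_smul _ _).symm
    have hr : (Real.fourierChar (-⟪t, p.2⟫) • (partialFourierDeriv g (p.1, t) : (E × F) →L[ℝ] G)) z =
        Real.fourierChar (-⟪t, p.2⟫) • (-(2 * Real.pi * Complex.I) •
          ((⟪t, z.2⟫ : ℝ) • g (p.1, t)) + fderiv ℝ g (p.1, t) (z.1, 0)) := rfl
    rw [hr, hs]
    simp only [add_apply, smul_apply,
      ContinuousLinearMap.smulRight_apply, ContinuousLinearMap.comp_apply, Complex.ofRealCLM_apply,
      ContinuousLinearMap.inl_apply, ContinuousLinearMap.coe_fst', innerSnd_apply, Circle.smul_def,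
      smul_add, smul_smul, smul_eq_mul]
    rw [add_comm]
    congr 2
    ring

end Slice

theorem contDiff_partialFourierFun (n : ℕ) : ∀ {G : Type} [NormedAddCommGroup G] [NormedSpace ℂ G]
    (g : 𝓢(E × F, G)), ContDiff ℝ n (partialFourierFun g) := by
  -- The target space `G` stays quantified: the inductive step passes to functions with values in
  -- $(E\times F)\to G$.
  induction n with
  | zero =>
    intro G _ _ g
    have : Differentiable ℝ (partialFourierFun g) := fun p =>
      (hasFDerivAt_partialFourierFun g p).differentiableAt
    exact contDiff_zero.mpr this.continuous
  | succ n ih =>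
    intro G _ _ g
    push_cast
    refine contDiff_succ_iff_fderiv.mpr ⟨fun p =>
      (hasFDerivAt_partialFourierFun g p).differentiableAt, by simp, ?_⟩
    have : fderiv ℝ (partialFourierFun g) = partialFourierFun (partialFourierDeriv g) :=
      funext fun p => (hasFDerivAt_partialFourierFun g p).fderiv
    rw [this]
    exact ih _

theorem exists_seminorm_bound_iteratedFDeriv_partialFourierFun (k n : ℕ) :
    ∀ {G : Type} [NormedAddCommGroup G] [NormedSpace ℂ G],
    ∃ q : Seminorm ℂ 𝓢(E × F, G), Continuous q ∧
      ∀ (g : 𝓢(E × F, G)) (p : E × F),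
        ‖p‖ ^ k * ‖iteratedFDeriv ℝ n (partialFourierFun g) p‖ ≤ q g := by
  induction n with
  | zero =>
    intro G _ _
    obtain ⟨q₁, hq₁, h₁⟩ := exists_seminorm_bound_partialFourierFun (E := E) (F := F) (G := G) k 0
    obtain ⟨q₂, hq₂, h₂⟩ := exists_seminorm_bound_partialFourierFun (E := E) (F := F) (G := G) 0 k
    refine ⟨q₁ + q₂, hq₁.add hq₂, fun g p => ?_⟩
    have h₁' := h₁ g p
    have h₂' := h₂ g p
    rw [pow_zero, one_mul] at h₁' h₂'
    rw [norm_iteratedFDeriv_zero, add_apply, Prod.norm_def]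
    rcases max_choice ‖p.1‖ ‖p.2‖ with h | h <;> rw [h]
    · linarith [apply_nonneg q₂ g]
    · linarith [apply_nonneg q₁ g]
  | succ n ih =>
    intro G _ _
    obtain ⟨q, hq, h⟩ := ih (G := (E × F) →L[ℝ] G)
    have hc : Continuous fun g : 𝓢(E × F, G) => q (partialFourierDeriv g) :=
      hq.comp partialFourierDeriv.continuous
    let q' : Seminorm ℂ 𝓢(E × F, G) :=
      q.comp (partialFourierDeriv (E := E) (F := F) (G := G)).toLinearMap
    refine ⟨q', hc, fun g p => ?_⟩
    have h1 : fderiv ℝ (partialFourierFun g) = partialFourierFun (partialFourierDeriv g) :=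
      funext fun p => (hasFDerivAt_partialFourierFun g p).fderiv
    rw [← norm_iteratedFDeriv_fderiv, h1]
    exact h _ p

/-- The partial Fourier transform in the second variable on Schwartz functions on `E × F`. -/
def partialFourier {G : Type} [NormedAddCommGroup G] [NormedSpace ℂ G] :
    𝓢(E × F, G) →L[ℂ] 𝓢(E × F, G) :=
  mkCLM partialFourierFun (fun f g p => by simp [partialFourierFun, FourierTransform.fourier_add])
    (fun a g p => by simp [partialFourierFun, FourierTransform.fourier_smul])
    (fun g => contDiff_infty.mpr fun n => contDiff_partialFourierFun n g)
    (fun m => by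
      obtain ⟨q, hq, h⟩ := exists_seminorm_bound_iteratedFDeriv_partialFourierFun (E := E) (F := F)
        m.1 m.2 (G := G)
      obtain ⟨s, C, -, hC⟩ :=
        Seminorm.bound_of_continuous (schwartz_withSeminorms ℂ (E × F) G) q hq
      exact ⟨s, C, C.2, fun g p => (h g p).trans (hC g)⟩)

theorem partialFourier_apply {G : Type} [NormedAddCommGroup G] [NormedSpace ℂ G]
    (g : 𝓢(E × F, G)) (p : E × F) :
    partialFourier g p = ∫ t, Real.fourierChar (-⟪t, p.2⟫) • g (p.1, t) :=
  partialFourierFun_eq g p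

end PartialFourier

/-! ### Symplectic Fourier transforms -/

section Symplectic

set_option linter.unusedSectionVars false

variable {W : Type} [NormedAddCommGroup W] [InnerProductSpace ℝ W]
  [FiniteDimensional ℝ W] [MeasurableSpace W] [BorelSpace W]

theorem finrank_dbl : Module.finrank ℝ (Dbl W) = Module.finrank ℝ W + Module.finrank ℝ W := by
  rw [(WithLp.linearEquiv 2 ℝ (W × W)).finrank_eq]
  exact Module.finrank_prod

theorem inner_rotate (c : ℝ) (hc : c ≠ 0) (z z' : Dbl W) :
    ⟪z, rotate c hc z'⟫ = c * sympForm z z' := by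
  have h : rotate c hc z' = pt (c • z'.snd) (-(c • z'.fst)) := rfl
  rw [h, WithLp.prod_inner_apply, sympForm]
  simp only [inner_neg_right, inner_smul_right]
  simp only [WithLp.ofLp_fst, WithLp.ofLp_snd, real_inner_comm]
  ring

theorem inner_rotateTwo (c : ℝ) (hc : c ≠ 0) (p p' : Dbl (Dbl W)) :
    ⟪p, rotateTwo c hc p'⟫ = c * sympFormTwo p p' := by
  have h : rotateTwo c hc p' = pt (rotate c hc p'.fst) (rotate (-c) (neg_ne_zero.mpr hc) p'.snd) :=
    rfl
  rw [h, WithLp.prod_inner_apply, sympFormTwo]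
  have h1 := inner_rotate c hc p.fst p'.fst
  have h2 := inner_rotate (-c) (neg_ne_zero.mpr hc) p.snd p'.snd
  simp only [WithLp.ofLp_fst, WithLp.ofLp_snd, h1, h2]
  ring

theorem sympForm_swap (z z' : Dbl W) : sympForm z z' = -sympForm z' z := by
  simp only [sympForm]
  ring

/-- The rotation `(x, y) ↦ (y, -x)`. -/
def rotateIsometry : Dbl W ≃ₗᵢ[ℝ] Dbl W where
  toLinearEquiv := (rotate (W := W) 1 one_ne_zero).toLinearEquiv
  norm_map' z := by
    have h : (rotate (W := W) 1 one_ne_zero).toLinearEquiv z = pt ((1 : ℝ) • z.snd) (-((1 : ℝ) • z.fst)) := rfl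
    rw [h, WithLp.prod_norm_eq_of_L2, WithLp.prod_norm_eq_of_L2]
    simp [add_comm]

/-- The map is a homothety followed by an isometry. The dimension is even, so the Jacobian needs no
absolute value. -/
theorem integral_comp_rotate (c : ℝ) (hc : c ≠ 0) (g : Dbl W → ℂ) :
    ∫ z, g (rotate c hc z) = ((c ^ (2 * Module.finrank ℝ W))⁻¹ : ℝ) • ∫ z, g z := by
  have h1 : ∀ z : Dbl W, rotate c hc z = rotateIsometry (c • z) := by
    intro z
    change pt (c • z.snd) (-(c • z.fst)) = pt ((1 : ℝ) • (c • z).snd) (-((1 : ℝ) • (c • z).fst))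
    simp
  simp_rw [h1]
  rw [Measure.integral_comp_smul volume (fun z => g (rotateIsometry z)) c, finrank_dbl, ← two_mul,
    abs_of_nonneg (inv_nonneg.mpr (by rw [pow_mul]; positivity))]
  congr 1
  exact (rotateIsometry (W := W)).measurePreserving.integral_comp'
    (f := (rotateIsometry (W := W)).toHomeomorph.toMeasurableEquiv) g

theorem fourierAlong_rotate_apply (ħ : ℝ) (hħ : ħ ≠ 0) (N : ℕ) (φ : 𝓢(Dbl W, ℂ)) (z : Dbl W) :
    fourierAlong (rotate (ħ / 2) (div_ne_zero hħ two_ne_zero)) N ħ φ z =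
      ((ħ / 2 : ℝ) : ℂ) ^ N *
        ∫ z', φ z' * Complex.exp ((Real.pi * ħ * sympForm z z' : ℝ) * Complex.I) := by
  rw [fourierAlong_apply]
  congr 2
  ext z'
  rw [inner_rotate, sympForm_swap z' z]
  congr 4
  ring

theorem fourierAlong_rotateTwo_apply (ħ : ℝ) (hħ : ħ ≠ 0) (N : ℕ) (φ : 𝓢(Dbl (Dbl W), ℂ))
    (p : Dbl (Dbl W)) :
    fourierAlong (rotateTwo (ħ / 2) (div_ne_zero hħ two_ne_zero)) N ħ φ p =
      ((ħ / 2 : ℝ) : ℂ) ^ N *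
        ∫ p', φ p' * Complex.exp ((Real.pi * ħ * sympFormTwo p p' : ℝ) * Complex.I) := by
  rw [fourierAlong_apply]
  congr 2
  ext p'
  have : sympFormTwo p' p = - sympFormTwo p p' := by
    simp only [sympFormTwo, sympForm]
    ring
  rw [inner_rotateTwo, this]
  congr 4
  ring

/-- The rotation is skew for the inner product, so after a change of variables the second transform
is an inverse Fourier transform. Its Jacobian $(\hbar/2)^{-2N}$ cancels the two normalizing factors.
-/
theorem fourierAlong_rotate_fourierAlong (ħ : ℝ) (hħ : ħ ≠ 0) (φ : 𝓢(Dbl W, ℂ)) :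
    fourierAlong (rotate (ħ / 2) (div_ne_zero hħ two_ne_zero)) (Module.finrank ℝ W) ħ
      (fourierAlong (rotate (ħ / 2) (div_ne_zero hħ two_ne_zero)) (Module.finrank ℝ W) ħ φ) = φ := by
  set c := ħ / 2 with hc
  have hc0 : c ≠ 0 := div_ne_zero hħ two_ne_zero
  set N := Module.finrank ℝ W
  ext z
  have h0 : ∀ z', fourierAlong (rotate c hc0) N ħ φ z' = (c : ℂ) ^ N * 𝓕 φ (rotate c hc0 z') :=
    fun z' => rfl
  rw [fourierAlong_apply]
  have h1 : ∀ z', fourierAlong (rotate c hc0) N ħ φ z' *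
      Complex.exp ((-2 * Real.pi * ⟪z', rotate c hc0 z⟫ : ℝ) * Complex.I) =
      (fun w => (c : ℂ) ^ N * (𝓕 φ w *
        Complex.exp ((2 * Real.pi * ⟪w, z⟫ : ℝ) * Complex.I))) (rotate c hc0 z') := by
    intro z'
    have : ⟪rotate c hc0 z', z⟫ = - ⟪z', rotate c hc0 z⟫ := by
      rw [real_inner_comm, inner_rotate, inner_rotate, sympForm_swap]
      ring
    simp only [h0, this, mul_assoc]
    congr 5
    ring
  refine (congrArg _ (integral_congr_ae (Filter.Eventually.of_forall h1))).trans ?_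
  refine (congrArg _ (integral_comp_rotate c hc0 (fun w => (c : ℂ) ^ N * (𝓕 φ w *
        Complex.exp ((2 * Real.pi * ⟪w, z⟫ : ℝ) * Complex.I))))).trans ?_
  rw [integral_const_mul]
  have h2 : ∫ w, 𝓕 φ w * Complex.exp ((2 * Real.pi * ⟪w, z⟫ : ℝ) * Complex.I) = φ z := by
    have h3 : 𝓕⁻ (𝓕 φ) z = φ z := by rw [FourierTransform.fourierInv_fourier_eq]
    rw [← h3, fourierInv_coe, Real.fourierInv_eq']
    simp only [smul_eq_mul, mul_comm]
  rw [h2, Complex.real_smul]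
  have : (c : ℂ) ≠ 0 := by exact_mod_cast hc0
  rw [← hc, show Module.finrank ℝ W = N from rfl, two_mul, pow_add]
  push_cast
  field_simp

/-! ### The change of variables `rearrange` -/

theorem rearrange_apply (υ : ℝ) (hυ : υ ≠ 0) (q : Dbl (Dbl W)) :
    rearrange υ hυ q = pt (pt q.fst.fst q.snd.fst) (pt (υ • q.snd.snd) (υ⁻¹ • q.fst.snd)) := rfl

/-- Exchanging position and momentum in the second pair absorbs the minus sign of `sympFormTwo`; the
scalings $\upsilon$ and $\upsilon^{-1}$ cancel. -/
theorem sympFormTwo_rearrange (υ : ℝ) (hυ : υ ≠ 0) (q q' : Dbl (Dbl W)) :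
    sympFormTwo (rearrange υ hυ q) (rearrange υ hυ q') = sympForm q q' := by
  simp only [rearrange_apply, sympFormTwo, sympForm, pt_fst, pt_snd, WithLp.prod_inner_apply,
    real_inner_smul_left, real_inner_smul_right, WithLp.ofLp_fst, WithLp.ofLp_snd]
  rw [real_inner_comm q'.snd.snd, real_inner_comm q.snd.snd]
  field_simp
  ring

theorem measurePreserving_smul_inv_smul (υ : ℝ) (hυ : υ ≠ 0) :
    MeasurePreserving (fun w : Dbl W => pt (υ • w.fst) (υ⁻¹ • w.snd)) := by
  have h1 : MeasurePreserving (fun w : W × W => (υ • w.1, υ⁻¹ • w.2)) := by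
    refine ⟨by fun_prop, ?_⟩
    change Measure.map (Prod.map (fun w : W => υ • w) (fun w : W => υ⁻¹ • w))
      ((volume : Measure W).prod volume) = (volume : Measure W).prod volume
    rw [← Measure.map_prod_map _ _ (by fun_prop) (by fun_prop), Measure.map_addHaar_smul _ hυ,
      Measure.map_addHaar_smul _ (inv_ne_zero hυ), Measure.prod_smul_left, Measure.prod_smul_right,
      smul_smul, ← ENNReal.ofReal_mul (abs_nonneg _), ← abs_mul]
    have : (υ ^ Module.finrank ℝ W)⁻¹ * (υ⁻¹ ^ Module.finrank ℝ W)⁻¹ = 1 := by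
      rw [inv_pow, inv_inv, inv_mul_cancel₀ (pow_ne_zero _ hυ)]
    rw [this, abs_one, ENNReal.ofReal_one, one_smul]
  exact (WithLp.volume_preserving_toLp W W).comp (h1.comp (WithLp.volume_preserving_ofLp W W))

/-- The permutation `((x₁, x₂), (y₁, y₂)) ↦ ((x₁, y₁), (y₂, x₂))`. -/
def permuteIsometry : Dbl (Dbl W) ≃ₗᵢ[ℝ] Dbl (Dbl W) where
  toLinearEquiv := (rearrange (W := W) 1 one_ne_zero).toLinearEquiv
  norm_map' q := by
    have h : (rearrange (W := W) 1 one_ne_zero).toLinearEquiv q =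
      pt (pt q.fst.fst q.snd.fst) (pt ((1 : ℝ) • q.snd.snd) ((1 : ℝ)⁻¹ • q.fst.snd)) := rfl
    rw [← sq_eq_sq₀ (norm_nonneg _) (norm_nonneg _), h]
    simp only [WithLp.prod_norm_sq_eq_of_L2, one_smul, inv_one, pt_fst, pt_snd]
    ring

theorem measurePreserving_rearrange (υ : ℝ) (hυ : υ ≠ 0) :
    MeasurePreserving (rearrange (W := W) υ hυ) := by
  have h1 : MeasurePreserving (fun p : Dbl W × Dbl W =>
      (p.1, pt (υ • p.2.fst) (υ⁻¹ • p.2.snd))) :=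
    (MeasurePreserving.id volume).prod (measurePreserving_smul_inv_smul υ hυ)
  have h2 := (WithLp.volume_preserving_toLp (Dbl W) (Dbl W)).comp
    (h1.comp (WithLp.volume_preserving_ofLp (Dbl W) (Dbl W)))
  have h3 := h2.comp (permuteIsometry (W := W)).measurePreserving
  convert h3 using 1
  ext1 q
  change pt (pt q.fst.fst q.snd.fst) (pt (υ • q.snd.snd) (υ⁻¹ • q.fst.snd)) =
    pt (pt q.fst.fst q.snd.fst) (pt (υ • (1 : ℝ) • q.snd.snd) (υ⁻¹ • (1 : ℝ)⁻¹ • q.fst.snd))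
  simp

theorem integral_comp_rearrange (υ : ℝ) (hυ : υ ≠ 0) (g : Dbl (Dbl W) → ℂ) :
    ∫ q, g (rearrange υ hυ q) = ∫ p, g p :=
  (measurePreserving_rearrange υ hυ).integral_comp'
    (f := (rearrange (W := W) υ hυ).toHomeomorph.toMeasurableEquiv) g

theorem fourierAlong_rotateTwo_comp_rearrange_symm (ħ υ : ℝ) (hħ : ħ ≠ 0) (hυ : υ ≠ 0)
    (ψ : 𝓢(Dbl (Dbl W), ℂ)) :
    fourierAlong (rotateTwo (ħ / 2) (div_ne_zero hħ two_ne_zero)) (2 * Module.finrank ℝ W) ħ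
      (compCLMOfContinuousLinearEquiv ℂ (rearrange (W := W) υ hυ).symm ψ) =
    compCLMOfContinuousLinearEquiv ℂ (rearrange (W := W) υ hυ).symm
      (fourierAlong (rotate (ħ / 2) (div_ne_zero hħ two_ne_zero))
        (Module.finrank ℝ (Dbl W)) ħ ψ) := by
  ext p
  obtain ⟨q, rfl⟩ := (rearrange (W := W) υ hυ).surjective p
  rw [compCLMOfContinuousLinearEquiv_apply, Function.comp_apply,
    ContinuousLinearEquiv.symm_apply_apply, fourierAlong_rotateTwo_apply ħ hħ,
    fourierAlong_rotate_apply ħ hħ, finrank_dbl, ← two_mul]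
  congr 1
  rw [← integral_comp_rearrange υ hυ]
  congr 1
  ext q'
  rw [sympFormTwo_rearrange]
  simp

/-- The transform commutes with the change of variables, so two transforms meet and cancel: the
kernel of the Weyl operator with symbol $\wideparen k\circ B$ is $k\circ B$. -/
theorem symbolDist_fourierAlong (ħ υ : ℝ) (hħ : ħ ≠ 0) (hυ : υ ≠ 0)
    (k : 𝓢'(Dbl (Dbl W), ℂ)) (φ : 𝓢(Dbl (Dbl W), ℂ)) :
    fourierDist (W := Dbl W) ħ hħ (symbolDist (W := W) ħ υ hħ hυ k) φ =
      k (compCLMOfContinuousLinearEquiv ℂ (rearrange (W := W) υ hυ).symm φ) := by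
  have h1 : ∀ (T : 𝓢'(Dbl (Dbl W), ℂ)) (φ : 𝓢(Dbl (Dbl W), ℂ)), fourierDist (W := Dbl W) ħ hħ T φ =
      T (fourierAlong (rotate (ħ / 2) (div_ne_zero hħ two_ne_zero))
        (Module.finrank ℝ (Dbl W)) ħ φ) := fun _ _ => rfl
  have h2 : ∀ (T : 𝓢'(Dbl (Dbl W), ℂ)) (φ : 𝓢(Dbl (Dbl W), ℂ)), fourierTwoDist (W := W) ħ hħ T φ =
      T (fourierAlong (rotateTwo (ħ / 2) (div_ne_zero hħ two_ne_zero))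
        (2 * Module.finrank ℝ W) ħ φ) := fun _ _ => rfl
  have h3 : ∀ φ : 𝓢(Dbl (Dbl W), ℂ), symbolDist (W := W) ħ υ hħ hυ k φ = fourierTwoDist (W := W) ħ hħ k
    (compCLMOfContinuousLinearEquiv ℂ (rearrange (W := W) υ hυ).symm φ) := fun _ => rfl
  rw [h1, h3, h2, fourierAlong_rotateTwo_comp_rearrange_symm ħ υ hħ hυ,
    fourierAlong_rotate_fourierAlong ħ hħ]

end Symplectic

/-! ### Phase shifts of Schwartz functions -/

section PhaseShift

theorem iteratedDeriv_cexp_ofReal_mul_I (n : ℕ) :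
    iteratedDeriv n (fun x : ℝ => Complex.exp (x * Complex.I)) =
      fun x : ℝ => Complex.I ^ n * Complex.exp (x * Complex.I) := by
  induction n with
  | zero => simp
  | succ n ih =>
    rw [iteratedDeriv_succ, ih]
    ext x
    have h1 : HasDerivAt (fun x : ℝ => (x : ℂ) * Complex.I) (1 * Complex.I) x :=
      (Complex.ofRealCLM.hasDerivAt (x := x)).mul_const Complex.I
    have h2 := (h1.cexp.const_mul (Complex.I ^ n)).deriv
    rw [h2]
    ring

theorem hasTemperateGrowth_cexp_ofReal_mul_I :
    Function.HasTemperateGrowth (fun x : ℝ => Complex.exp (x * Complex.I)) := by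
  refine ⟨(Complex.ofRealCLM.contDiff.mul contDiff_const).cexp, fun n => ⟨0, 1, fun x => ?_⟩⟩
  rw [norm_iteratedFDeriv_eq_norm_iteratedDeriv, iteratedDeriv_cexp_ofReal_mul_I]
  simp [Complex.norm_exp_ofReal_mul_I]

theorem _root_.Function.HasTemperateGrowth.cexp_mul_I {E : Type*} [NormedAddCommGroup E]
    [NormedSpace ℝ E] {θ : E → ℝ} (hθ : θ.HasTemperateGrowth) :
    Function.HasTemperateGrowth (fun z => Complex.exp (θ z * Complex.I)) :=
  hasTemperateGrowth_cexp_ofReal_mul_I.comp hθ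

variable {W : Type} [NormedAddCommGroup W] [InnerProductSpace ℝ W]

/-- `f(t) ↦ exp(i θ(t)) f(t - a)` on Schwartz functions. -/
def phaseShiftSchwartz (θ : W → ℝ) (a : W) : 𝓢(W, ℂ) →L[ℂ] 𝓢(W, ℂ) :=
  smulLeftCLM ℂ (fun t => Complex.exp (θ t * Complex.I)) ∘L compSubConstCLM ℂ a

theorem phaseShiftSchwartz_apply {θ : W → ℝ} (hθ : θ.HasTemperateGrowth) (a : W) (u : 𝓢(W, ℂ))
    (t : W) : phaseShiftSchwartz θ a u t = Complex.exp (θ t * Complex.I) * u (t - a) := by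
  simp [phaseShiftSchwartz, smulLeftCLM_apply_apply hθ.cexp_mul_I]

theorem hasTemperateGrowth_fst :
    Function.HasTemperateGrowth (fun z : Dbl W => z.fst) :=
  (WithLp.fstL 2 ℝ W W).hasTemperateGrowth

theorem hasTemperateGrowth_snd :
    Function.HasTemperateGrowth (fun z : Dbl W => z.snd) :=
  (WithLp.sndL 2 ℝ W W).hasTemperateGrowth

theorem hasTemperateGrowth_leftPhase (ħ s : ℝ) (x y : W) :
    Function.HasTemperateGrowth
      (fun z : Dbl W => Real.pi * ħ * (s + ⟪x, z.snd⟫ - ⟪y, z.fst⟫)) := by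
  have h1 := ((innerSL ℝ x) ∘L WithLp.sndL 2 ℝ W W).hasTemperateGrowth
  have h2 := ((innerSL ℝ y) ∘L WithLp.fstL 2 ℝ W W).hasTemperateGrowth
  exact (Function.HasTemperateGrowth.const (Real.pi * ħ)).mul
    (((Function.HasTemperateGrowth.const s).add h1).sub h2)

theorem hasTemperateGrowth_schrodingerPhase (ħ s d : ℝ) (y : W) :
    Function.HasTemperateGrowth
      (fun t : W => Real.pi * ħ * (s - 2 * ⟪y, t⟫ + d)) := by
  have h1 := (innerSL ℝ y).hasTemperateGrowth
  exact (Function.HasTemperateGrowth.const (Real.pi * ħ)).mul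
    (((Function.HasTemperateGrowth.const s).sub
      ((Function.HasTemperateGrowth.const (2 : ℝ)).mul h1)).add
        (Function.HasTemperateGrowth.const d))

/-- `Λ_ħ(g)` on Schwartz functions. -/
def leftSchwartz (ħ : ℝ) (g : Heis W) : 𝓢(Dbl W, ℂ) →L[ℂ] 𝓢(Dbl W, ℂ) :=
  phaseShiftSchwartz (fun z => Real.pi * ħ * (2 * g.s + ⟪g.x, z.snd⟫ - ⟪g.y, z.fst⟫)) (pt g.x g.y)

/-- `R_ħ(g)` on Schwartz functions. -/
def rightSchwartz (ħ : ℝ) (g : Heis W) : 𝓢(Dbl W, ℂ) →L[ℂ] 𝓢(Dbl W, ℂ) :=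
  phaseShiftSchwartz (fun z => Real.pi * ħ * (-2 * g.s + ⟪g.x, z.snd⟫ - ⟪g.y, z.fst⟫))
    (-pt g.x g.y)

/-- `ρ_ħ(g)` on Schwartz functions. -/
def schrodingerSchwartz (ħ : ℝ) (g : Heis W) : 𝓢(W, ℂ) →L[ℂ] 𝓢(W, ℂ) :=
  phaseShiftSchwartz (fun t => Real.pi * ħ * (2 * g.s - 2 * ⟪g.y, t⟫ + ⟪g.x, g.y⟫)) g.x

theorem leftSchwartz_apply (ħ : ℝ) (g : Heis W) (u : 𝓢(Dbl W, ℂ)) (z : Dbl W) :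
    leftSchwartz ħ g u z = leftFun ħ g u z := by
  rw [leftFun_apply]
  exact phaseShiftSchwartz_apply (hasTemperateGrowth_leftPhase ħ _ _ _) _ u z

theorem rightSchwartz_apply (ħ : ℝ) (g : Heis W) (u : 𝓢(Dbl W, ℂ)) (z : Dbl W) :
    rightSchwartz ħ g u z = rightFun ħ g u z := by
  rw [rightFun_apply, rightSchwartz,
    phaseShiftSchwartz_apply (hasTemperateGrowth_leftPhase ħ _ _ _), sub_neg_eq_add]

theorem schrodingerSchwartz_apply (ħ : ℝ) (g : Heis W) (u : 𝓢(W, ℂ)) (t : W) :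
    schrodingerSchwartz ħ g u t = schrodingerFun ħ g u t :=
  phaseShiftSchwartz_apply (hasTemperateGrowth_schrodingerPhase ħ _ _ _) _ u t

variable [FiniteDimensional ℝ W] [MeasurableSpace W] [BorelSpace W]

theorem phaseShift_toLp {θ : W → ℝ} (hθ : θ.HasTemperateGrowth) (hθ' : Continuous θ) (a : W)
    (u : 𝓢(W, ℂ)) :
    phaseShift θ hθ' a (u.toLp 2) = (phaseShiftSchwartz θ a u).toLp 2 := by
  refine Lp.ext ?_
  have h := (measurePreserving_sub_right volume a).quasiMeasurePreserving.ae_eq_comp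
    (u.coeFn_toLp 2 (volume : Measure W))
  filter_upwards [phaseShift_coeFn θ hθ' a (u.toLp 2), (phaseShiftSchwartz θ a u).coeFn_toLp 2, h]
    with t h1 h2 h3
  simp only [Function.comp_apply] at h3
  rw [h1, h2, h3, phaseShiftSchwartz_apply hθ]

theorem left_toLp (ħ : ℝ) (g : Heis W) (u : 𝓢(Dbl W, ℂ)) :
    left ħ g (u.toLp 2) = (leftSchwartz ħ g u).toLp 2 :=
  phaseShift_toLp (hasTemperateGrowth_leftPhase ħ _ _ _) _ _ u

theorem right_toLp (ħ : ℝ) (g : Heis W) (u : 𝓢(Dbl W, ℂ)) :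
    right ħ g (u.toLp 2) = (rightSchwartz ħ g u).toLp 2 :=
  phaseShift_toLp (hasTemperateGrowth_leftPhase ħ _ _ _) _ _ u

theorem schrodinger_toLp (ħ : ℝ) (g : Heis W) (u : 𝓢(W, ℂ)) :
    schrodinger ħ g (u.toLp 2) = (schrodingerSchwartz ħ g u).toLp 2 :=
  phaseShift_toLp (hasTemperateGrowth_schrodingerPhase ħ _ _ _) _ _ u

theorem denseRange_toLp : DenseRange fun u : 𝓢(W, ℂ) => (u.toLp 2 : L2 W) :=
  denseRange_toLpCLM ENNReal.ofNat_ne_top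

theorem norm_toLp_two_eq_of_integral {u v : 𝓢(W, ℂ)} (h : ∫ t, ‖u t‖ ^ 2 = ∫ t, ‖v t‖ ^ 2) :
    ‖(u.toLp 2 : L2 W)‖ = ‖(v.toLp 2 : L2 W)‖ := by
  rw [norm_toLp' two_ne_zero ENNReal.ofNat_ne_top, norm_toLp' two_ne_zero ENNReal.ofNat_ne_top]
  simp only [ENNReal.toReal_ofNat, Real.rpow_ofNat, h]

end PhaseShift

/-! ### Oscillatory integral operators with quadratic phases -/

section Oscillatory

set_option linter.unusedSectionVars false

variable {W : Type} [NormedAddCommGroup W] [InnerProductSpace ℝ W]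

/-- The function `(x, y) ↦ c exp(i a ⟪x, y⟫)`. -/
def chirp (c : ℂ) (a : ℝ) (z : Dbl W) : ℂ :=
  c * Complex.exp ((a * ⟪z.fst, z.snd⟫ : ℝ) * Complex.I)

theorem hasTemperateGrowth_chirp (c : ℂ) (a : ℝ) :
    Function.HasTemperateGrowth (chirp c a : Dbl W → ℂ) := by
  have h1 : Function.HasTemperateGrowth (fun z : Dbl W => (⟪z.fst, z.snd⟫ : ℝ)) :=
    (innerSL ℝ).bilinear_hasTemperateGrowth hasTemperateGrowth_fst hasTemperateGrowth_snd
  exact (Function.HasTemperateGrowth.const c).mul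
    ((Function.HasTemperateGrowth.const a).mul h1).cexp_mul_I

theorem norm_chirp (c : ℂ) (a : ℝ) (z : Dbl W) : ‖chirp c a z‖ = ‖c‖ := by
  rw [chirp, norm_mul, Complex.norm_exp_ofReal_mul_I, mul_one]

/-- Multiplication by a chirp. -/
def chirpEquiv (c : ℂ) (hc : c ≠ 0) (a : ℝ) : 𝓢(Dbl W, ℂ) ≃L[ℂ] 𝓢(Dbl W, ℂ) :=
  ContinuousLinearEquiv.equivOfInverse (smulLeftCLM ℂ (chirp c a)) (smulLeftCLM ℂ (chirp c⁻¹ (-a)))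
    (fun u => by
      ext z
      rw [smulLeftCLM_apply_apply (hasTemperateGrowth_chirp _ _),
        smulLeftCLM_apply_apply (hasTemperateGrowth_chirp _ _), smul_smul, chirp, chirp,
        mul_mul_mul_comm, inv_mul_cancel₀ hc, ← Complex.exp_add]
      simp)
    (fun u => by
      ext z
      rw [smulLeftCLM_apply_apply (hasTemperateGrowth_chirp _ _),
        smulLeftCLM_apply_apply (hasTemperateGrowth_chirp _ _), smul_smul, chirp, chirp,
        mul_mul_mul_comm, mul_inv_cancel₀ hc, ← Complex.exp_add]
      simp)

theorem chirpEquiv_apply (c : ℂ) (hc : c ≠ 0) (a : ℝ) (u : 𝓢(Dbl W, ℂ)) (z : Dbl W) :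
    chirpEquiv c hc a u z = chirp c a z * u z :=
  smulLeftCLM_apply_apply (hasTemperateGrowth_chirp _ _) u z

/-- Composition with a continuous linear equivalence. -/
def compEquiv (J : W ≃L[ℝ] W) : 𝓢(W, ℂ) ≃L[ℂ] 𝓢(W, ℂ) :=
  ContinuousLinearEquiv.equivOfInverse (compCLMOfContinuousLinearEquiv ℂ J)
    (compCLMOfContinuousLinearEquiv ℂ J.symm)
    (fun u => by ext z; simp) (fun u => by ext z; simp)

variable [FiniteDimensional ℝ W]

/-- The map `(x, y) ↦ (α y, β x)`. -/
def swapScale (α β : ℝ) (hα : α ≠ 0) (hβ : β ≠ 0) : Dbl W ≃L[ℝ] Dbl W :=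
  LinearEquiv.toContinuousLinearEquiv
    { toFun := fun z => pt (α • z.snd) (β • z.fst)
      invFun := fun z => pt (β⁻¹ • z.snd) (α⁻¹ • z.fst)
      map_add' := fun z w => by
        apply WithLp.ofLp_injective
        ext <;> simp
      map_smul' := fun r z => by
        apply WithLp.ofLp_injective
        ext <;> simp [smul_comm _ r]
      left_inv := fun z => by
        apply WithLp.ofLp_injective
        ext <;> simp [smul_smul, hα, hβ]
      right_inv := fun z => by
        apply WithLp.ofLp_injective
        ext <;> simp [smul_smul, hα, hβ] }

theorem inner_swapScale (α β : ℝ) (hα : α ≠ 0) (hβ : β ≠ 0) (z t : Dbl W) :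
    ⟪z, swapScale α β hα hβ t⟫ = α * ⟪z.fst, t.snd⟫ + β * ⟪z.snd, t.fst⟫ := by
  have h : swapScale α β hα hβ t = pt (α • t.snd) (β • t.fst) := rfl
  rw [h, WithLp.prod_inner_apply]
  simp only [real_inner_smul_right, WithLp.ofLp_fst, WithLp.ofLp_snd]

variable [MeasurableSpace W] [BorelSpace W]

/-- The operator `u ↦ c exp(i b ⟪t₁, t₂⟫) 𝓕(exp(i a ⟪z₁, z₂⟫) u)(J t)`. -/
def oscEquiv (c : ℂ) (hc : c ≠ 0) (a b : ℝ) (J : Dbl W ≃L[ℝ] Dbl W) :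
    𝓢(Dbl W, ℂ) ≃L[ℂ] 𝓢(Dbl W, ℂ) :=
  (((chirpEquiv 1 one_ne_zero a).trans (FourierTransform.fourierCLE ℂ 𝓢(Dbl W, ℂ))).trans
    (compEquiv J)).trans (chirpEquiv c hc b)

theorem oscEquiv_apply (c : ℂ) (hc : c ≠ 0) (a b : ℝ) (J : Dbl W ≃L[ℝ] Dbl W)
    (u : 𝓢(Dbl W, ℂ)) (t : Dbl W) :
    oscEquiv c hc a b J u t = chirp c b t * 𝓕 (chirpEquiv 1 one_ne_zero a u) (J t) := by
  rw [oscEquiv, ContinuousLinearEquiv.trans_apply, chirpEquiv_apply]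
  rfl

theorem oscEquiv_apply_eq_integral (c : ℂ) (hc : c ≠ 0) (a b : ℝ) (J : Dbl W ≃L[ℝ] Dbl W)
    (u : 𝓢(Dbl W, ℂ)) (t : Dbl W) :
    oscEquiv c hc a b J u t = c * ∫ z, Complex.exp ((b * ⟪t.fst, t.snd⟫ - 2 * Real.pi * ⟪z, J t⟫ +
      a * ⟪z.fst, z.snd⟫ : ℝ) * Complex.I) * u z := by
  rw [oscEquiv_apply, fourier_coe, Real.fourier_eq', chirp, mul_assoc, ← integral_const_mul]
  congr 2
  ext z
  rw [chirpEquiv_apply, chirp, one_mul, smul_eq_mul, ← mul_assoc, ← mul_assoc, ← Complex.exp_add,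
    ← Complex.exp_add]
  congr 2
  push_cast
  ring

/-- The multiplication formula $\int\hat f g=\int f\hat g$ for the bilinear form $\langle
z,Jt\rangle$: transposition exchanges the two chirps and replaces $J$ by its transpose. -/
theorem integral_oscEquiv_mul (c : ℂ) (hc : c ≠ 0) (a b : ℝ) (J J' : Dbl W ≃L[ℝ] Dbl W)
    (hJ : ∀ z t, ⟪z, J t⟫ = ⟪t, J' z⟫) (u v : 𝓢(Dbl W, ℂ)) :
    ∫ t, oscEquiv c hc a b J u t * v t = ∫ z, u z * oscEquiv c hc b a J' v z := by
  let L : Dbl W →ₗ[ℝ] Dbl W →ₗ[ℝ] ℝ := (innerₗ (Dbl W)).compl₂ (J : Dbl W →ₗ[ℝ] Dbl W)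
  have hL : Continuous fun p : Dbl W × Dbl W => L p.1 p.2 := by
    change Continuous fun p : Dbl W × Dbl W => ⟪p.1, J p.2⟫
    exact continuous_fst.inner (J.continuous.comp continuous_snd)
  have key := VectorFourier.integral_fourierIntegral_smul_eq_flip (μ := volume) (ν := volume)
    (L := L) Real.continuous_fourierChar hL (chirpEquiv 1 one_ne_zero a u).integrable
    (chirpEquiv 1 one_ne_zero b v).integrable
  have h1 : ∀ t, VectorFourier.fourierIntegral Real.fourierChar volume L
      (chirpEquiv 1 one_ne_zero a u) t = 𝓕 (chirpEquiv 1 one_ne_zero a u) (J t) := fun t => rfl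
  have h2 : ∀ z, VectorFourier.fourierIntegral Real.fourierChar volume L.flip
      (chirpEquiv 1 one_ne_zero b v) z = 𝓕 (chirpEquiv 1 one_ne_zero b v) (J' z) := by
    intro z
    rw [fourier_coe, Real.fourier_eq]
    refine integral_congr_ae (Filter.Eventually.of_forall fun t => ?_)
    change Real.fourierChar (-⟪z, J t⟫) • _ = _
    rw [hJ]
  simp only [h1, h2, smul_eq_mul] at key
  calc _ = c * ∫ t, 𝓕 (chirpEquiv 1 one_ne_zero a u) (J t) * chirpEquiv 1 one_ne_zero b v t := by
        rw [← integral_const_mul]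
        congr 1
        ext t
        rw [oscEquiv_apply, chirpEquiv_apply _ _ b, chirp, chirp]
        ring
    _ = c * ∫ z, chirpEquiv 1 one_ne_zero a u z * 𝓕 (chirpEquiv 1 one_ne_zero b v) (J' z) := by
        rw [key]
    _ = _ := by
        rw [← integral_const_mul]
        congr 1
        ext t
        rw [oscEquiv_apply, chirpEquiv_apply _ _ a, chirp, chirp]
        ring

theorem det_ne_zero_of_equiv (J : Dbl W ≃L[ℝ] Dbl W) :
    LinearMap.det (J : Dbl W →ₗ[ℝ] Dbl W) ≠ 0 :=
  (LinearEquiv.isUnit_det' J.toLinearEquiv).ne_zero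

theorem integral_comp_equiv (J : Dbl W ≃L[ℝ] Dbl W) (g : Dbl W → ℝ) :
    ∫ t, g (J t) = |LinearMap.det (J : Dbl W →ₗ[ℝ] Dbl W)|⁻¹ * ∫ z, g z := by
  have h := Measure.map_linearMap_addHaar_eq_smul_addHaar (volume : Measure (Dbl W))
    (det_ne_zero_of_equiv J)
  have h2 : ∫ t, g (J t) = ∫ z, g z ∂(Measure.map J volume) :=
    (integral_map_equiv J.toHomeomorph.toMeasurableEquiv g).symm
  have h3 : Measure.map J (volume : Measure (Dbl W)) =
    Measure.map (J : Dbl W →ₗ[ℝ] Dbl W) volume := rfl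
  rw [h2, h3, h, integral_smul_measure, ENNReal.toReal_ofReal (abs_nonneg _), abs_inv, smul_eq_mul]

/-- Plancherel: the inner chirp is unimodular, and $|c|^2$ compensates the Jacobian $|\det J|^{-1}$
of the substitution. -/
theorem norm_oscEquiv_toLp (c : ℂ) (hc : c ≠ 0) (a b : ℝ) (J : Dbl W ≃L[ℝ] Dbl W)
    (h : ‖c‖ ^ 2 = |LinearMap.det (J : Dbl W →ₗ[ℝ] Dbl W)|) (u : 𝓢(Dbl W, ℂ)) :
    ‖((oscEquiv c hc a b J u).toLp 2 : L2 (Dbl W))‖ = ‖(u.toLp 2 : L2 (Dbl W))‖ := by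
  apply norm_toLp_two_eq_of_integral
  have h1 : ∀ t, ‖oscEquiv c hc a b J u t‖ ^ 2 =
      ‖c‖ ^ 2 * (fun z => ‖𝓕 (chirpEquiv 1 one_ne_zero a u) z‖ ^ 2) (J t) := by
    intro t
    rw [oscEquiv_apply, norm_mul, norm_chirp, mul_pow]
  simp_rw [h1]
  have h2 := integral_comp_equiv J (fun z => ‖𝓕 (chirpEquiv 1 one_ne_zero a u) z‖ ^ 2)
  rw [integral_const_mul, h2, integral_norm_sq_fourier, ← mul_assoc, h, mul_inv_cancel₀, one_mul]
  · congr 1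
    ext z
    rw [chirpEquiv_apply, norm_mul, norm_chirp, norm_one, one_mul]
  · exact abs_ne_zero.mpr (det_ne_zero_of_equiv J)

end Oscillatory

/-! ### The intertwining operator -/

section Intertwiner

set_option linter.unusedSectionVars false

variable {W : Type} [NormedAddCommGroup W] [InnerProductSpace ℝ W] [FiniteDimensional ℝ W]
  [MeasurableSpace W] [BorelSpace W]

variable {ħ υ : ℝ} (hħ : ħ ≠ 0) (hυ : υ ≠ 0)

variable (W) in
/-- The linear substitution `(t₁, t₂) ↦ (-(ħ / υ) t₂, ħ t₁)`. -/
def frequencyMap : Dbl W ≃L[ℝ] Dbl W :=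
  swapScale (-(ħ / υ)) ħ (neg_ne_zero.mpr (div_ne_zero hħ hυ)) hħ

variable (W) in
/-- The transpose of `frequencyMap`. -/
def frequencyMapTranspose : Dbl W ≃L[ℝ] Dbl W :=
  swapScale ħ (-(ħ / υ)) hħ (neg_ne_zero.mpr (div_ne_zero hħ hυ))

variable (W) in
/-- The normalizing constant of the intertwining operator. -/
def intertwinerConst : ℂ :=
  (Real.sqrt |LinearMap.det (frequencyMap W hħ hυ : Dbl W →ₗ[ℝ] Dbl W)| : ℝ)

theorem norm_intertwinerConst_sq : ‖intertwinerConst W hħ hυ‖ ^ 2 =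
    |LinearMap.det (frequencyMap W hħ hυ : Dbl W →ₗ[ℝ] Dbl W)| := by
  rw [intertwinerConst, Complex.norm_real, Real.norm_of_nonneg (Real.sqrt_nonneg _),
    Real.sq_sqrt (abs_nonneg _)]

theorem intertwinerConst_ne_zero : intertwinerConst W hħ hυ ≠ 0 := by
  intro h
  have h1 := norm_intertwinerConst_sq (W := W) hħ hυ
  rw [h, norm_zero, zero_pow two_ne_zero] at h1
  exact abs_ne_zero.mpr (det_ne_zero_of_equiv (frequencyMap W hħ hυ)) h1.symm

variable (W) in
/-- The intertwining operator on Schwartz functions. -/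
def intertwinerSchwartz : 𝓢(Dbl W, ℂ) ≃L[ℂ] 𝓢(Dbl W, ℂ) :=
  oscEquiv (intertwinerConst W hħ hυ) (intertwinerConst_ne_zero hħ hυ) (Real.pi * ħ)
    (-(2 * Real.pi * ħ / υ)) (frequencyMap W hħ hυ)

variable (W) in
/-- The transpose of the intertwining operator on Schwartz functions. -/
def intertwinerTranspose : 𝓢(Dbl W, ℂ) ≃L[ℂ] 𝓢(Dbl W, ℂ) :=
  oscEquiv (intertwinerConst W hħ hυ) (intertwinerConst_ne_zero hħ hυ) (-(2 * Real.pi * ħ / υ))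
    (Real.pi * ħ) (frequencyMapTranspose W hħ hυ)

variable (W) in
/-- The unitary intertwining operator. -/
def intertwiner : L2 (Dbl W) ≃ₗᵢ[ℂ] L2 (Dbl W) :=
  (intertwinerSchwartz W hħ hυ).toLinearEquiv.extendOfIsometry
    (toLpCLM ℂ (E := Dbl W) ℂ 2 volume) (toLpCLM ℂ (E := Dbl W) ℂ 2 volume)
    (denseRange_toLpCLM ENNReal.ofNat_ne_top) (denseRange_toLpCLM ENNReal.ofNat_ne_top)
    (norm_oscEquiv_toLp _ _ _ _ _ (norm_intertwinerConst_sq hħ hυ))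

variable (W) in
/-- The intertwining operator on tempered distributions. -/
def intertwinerDist : 𝓢'(Dbl W, ℂ) ≃L[ℂ] 𝓢'(Dbl W, ℂ) :=
  ContinuousLinearEquiv.equivOfInverse
    (PointwiseConvergenceCLM.precomp ℂ
      (intertwinerTranspose W hħ hυ : 𝓢(Dbl W, ℂ) →L[ℂ] 𝓢(Dbl W, ℂ)))
    (PointwiseConvergenceCLM.precomp ℂ
      ((intertwinerTranspose W hħ hυ).symm : 𝓢(Dbl W, ℂ) →L[ℂ] 𝓢(Dbl W, ℂ)))
    (fun T => by
      ext φ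
      exact congrArg T ((intertwinerTranspose W hħ hυ).apply_symm_apply φ))
    (fun T => by
      ext φ
      exact congrArg T ((intertwinerTranspose W hħ hυ).symm_apply_apply φ))

theorem intertwinerDist_apply (T : 𝓢'(Dbl W, ℂ)) (φ : 𝓢(Dbl W, ℂ)) :
    intertwinerDist W hħ hυ T φ = T (intertwinerTranspose W hħ hυ φ) := rfl

theorem intertwiner_toLp (u : 𝓢(Dbl W, ℂ)) :
    intertwiner W hħ hυ (u.toLp 2) = (intertwinerSchwartz W hħ hυ u).toLp 2 :=
  LinearEquiv.extendOfIsometry_eq _ _ _ _ _ _ u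

theorem intertwiner_symm_toLp (u : 𝓢(Dbl W, ℂ)) :
    (intertwiner W hħ hυ).symm (u.toLp 2) = ((intertwinerSchwartz W hħ hυ).symm u).toLp 2 :=
  LinearEquiv.extendOfIsometry_symm_eq _ _ _ _ _ _ u

theorem integral_intertwinerSchwartz_mul (u v : 𝓢(Dbl W, ℂ)) :
    ∫ t, intertwinerSchwartz W hħ hυ u t * v t = ∫ z, u z * intertwinerTranspose W hħ hυ v z := by
  refine integral_oscEquiv_mul _ _ _ _ _ _ (fun z t => ?_) u v
  rw [frequencyMap, frequencyMapTranspose, inner_swapScale, inner_swapScale,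
    real_inner_comm z.fst, real_inner_comm z.snd]
  ring

/-- Both sides are continuous in $f$, and on the dense Schwartz functions the claim is the
transposition formula. -/
theorem intertwinerDist_toTemperedDistribution (f : L2 (Dbl W)) :
    intertwinerDist W hħ hυ (Lp.toTemperedDistribution f) =
      Lp.toTemperedDistribution (intertwiner W hħ hυ f) := by
  refine denseRange_toLp.induction_on (p := fun f => intertwinerDist W hħ hυ
    (Lp.toTemperedDistribution f) = Lp.toTemperedDistribution (intertwiner W hħ hυ f)) f ?_ ?_
  · have hc := (Lp.toTemperedDistributionCLM ℂ (volume : Measure (Dbl W)) 2).continuous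
    exact isClosed_eq ((intertwinerDist W hħ hυ).continuous.comp hc)
      (hc.comp (intertwiner W hħ hυ).continuous)
  · intro u
    ext v
    rw [intertwiner_toLp, intertwinerDist_apply, Lp.toTemperedDistribution_toLp_eq,
      Lp.toTemperedDistribution_toLp_eq,
      toTemperedDistributionCLM_apply_apply (volume : Measure (Dbl W)),
      toTemperedDistributionCLM_apply_apply (volume : Measure (Dbl W))]
    simp only [smul_eq_mul]
    have h := integral_intertwinerSchwartz_mul hħ hυ u v
    simp only [mul_comm] at h ⊢
    exact h.symm

theorem intertwinerSchwartz_apply (u : 𝓢(Dbl W, ℂ)) (t : Dbl W) :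
    intertwinerSchwartz W hħ hυ u t = intertwinerConst W hħ hυ *
      ∫ z, Complex.exp ((Real.pi * ħ * (⟪z.fst, z.snd⟫ + 2 / υ * ⟪z.fst, t.snd⟫ -
        2 * ⟪z.snd, t.fst⟫ - 2 / υ * ⟪t.fst, t.snd⟫) : ℝ) * Complex.I) * u z := by
  rw [intertwinerSchwartz, oscEquiv_apply_eq_integral]
  congr 2
  ext z
  rw [frequencyMap, inner_swapScale]
  congr 4
  field_simp
  ring

/-- The intertwined representation on Schwartz functions. -/
def doubledSchwartz (ħ υ : ℝ) (g : Heis (Dbl W)) : 𝓢(Dbl W, ℂ) →L[ℂ] 𝓢(Dbl W, ℂ) :=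
  leftSchwartz ħ ⟨g.s, g.x.fst, g.y.fst⟩ ∘L rightSchwartz ħ ⟨0, υ • g.y.snd, υ⁻¹ • g.x.snd⟩

theorem doubled_toLp (ħ υ : ℝ) (g : Heis (Dbl W)) (u : 𝓢(Dbl W, ℂ)) :
    doubled ħ υ g (u.toLp 2) = (doubledSchwartz ħ υ g u).toLp 2 := by
  rw [doubled, ContinuousLinearMap.comp_apply, right_toLp, left_toLp]
  rfl

/-- Evaluation at the translated point undoes the net shift of the left and right actions, leaving
$u(w)$ with a phase; this is the form used under the integral of the intertwining operator. -/
theorem doubledSchwartz_apply_add (ħ υ : ℝ) (g : Heis (Dbl W)) (u : 𝓢(Dbl W, ℂ)) (w : Dbl W) :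
    doubledSchwartz ħ υ g u (w + (pt g.x.fst g.y.fst - pt (υ • g.y.snd) (υ⁻¹ • g.x.snd))) =
      Complex.exp ((Real.pi * ħ * (2 * g.s +
        ⟪g.x.fst, w.snd + (g.y.fst - υ⁻¹ • g.x.snd)⟫ - ⟪g.y.fst, w.fst + (g.x.fst - υ • g.y.snd)⟫ +
        (⟪υ • g.y.snd, w.snd - υ⁻¹ • g.x.snd⟫ - ⟪υ⁻¹ • g.x.snd, w.fst - υ • g.y.snd⟫)) : ℝ) *
          Complex.I) * u w := by
  rw [doubledSchwartz, ContinuousLinearMap.comp_apply, leftSchwartz_apply, leftFun_apply,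
    rightSchwartz_apply, rightFun_apply]
  have h1 : w + (pt g.x.fst g.y.fst - pt (υ • g.y.snd) (υ⁻¹ • g.x.snd)) - pt g.x.fst g.y.fst =
      w - pt (υ • g.y.snd) (υ⁻¹ • g.x.snd) := by abel
  rw [h1, sub_add_cancel, ← mul_assoc, ← Complex.exp_add]
  congr 2
  rw [← add_mul, ← Complex.ofReal_add]
  congr 2
  simp only [WithLp.add_fst, WithLp.add_snd, WithLp.sub_fst, WithLp.sub_snd, pt_fst, pt_snd]
  ring

/-- Translating the integration variable by the net shift of the two-sided action removes the group
element from $u$. What remains is equality of two phases, polynomial in $w$, $t$ and $g$; the kernel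
of $U$ is chosen so that they agree. -/
theorem intertwinerSchwartz_doubledSchwartz (g : Heis (Dbl W)) (u : 𝓢(Dbl W, ℂ)) :
    intertwinerSchwartz W hħ hυ (doubledSchwartz ħ υ g u) =
      schrodingerSchwartz ħ g (intertwinerSchwartz W hħ hυ u) := by
  ext t
  rw [schrodingerSchwartz_apply, schrodingerFun, intertwinerSchwartz_apply,
    intertwinerSchwartz_apply, mul_left_comm]
  congr 1
  rw [← integral_const_mul,
    ← integral_add_right_eq_self _ (pt g.x.fst g.y.fst - pt (υ • g.y.snd) (υ⁻¹ • g.x.snd))]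
  congr 1
  ext w
  rw [doubledSchwartz_apply_add, ← mul_assoc, ← mul_assoc, ← Complex.exp_add, ← Complex.exp_add]
  congr 2
  rw [← add_mul, ← add_mul, ← Complex.ofReal_add, ← Complex.ofReal_add]
  congr 2
  simp only [WithLp.add_fst, WithLp.add_snd, WithLp.sub_fst, WithLp.sub_snd,
    WithLp.prod_inner_apply, inner_add_left, inner_add_right, inner_sub_left, inner_sub_right,
    real_inner_smul_left, real_inner_smul_right, WithLp.ofLp_fst, WithLp.ofLp_snd, pt_fst, pt_snd]
  -- Each inner product is put in one order, so that `ring` sees a single atom for each pair.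
  rw [real_inner_comm w.snd g.y.snd, real_inner_comm w.snd g.x.fst, real_inner_comm w.fst g.y.fst,
    real_inner_comm w.fst g.x.snd, real_inner_comm g.y.snd g.x.snd, real_inner_comm g.x.fst g.y.fst,
    real_inner_comm g.y.fst g.y.snd, real_inner_comm t.fst g.x.snd]
  field_simp
  ring

theorem schrodinger_eq_intertwiner_doubled (g : Heis (Dbl W)) (f : L2 (Dbl W)) :
    schrodinger ħ g f = intertwiner W hħ hυ (doubled ħ υ g ((intertwiner W hħ hυ).symm f)) := by
  refine denseRange_toLp.induction_on (p := fun f => schrodinger ħ g f =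
    intertwiner W hħ hυ (doubled ħ υ g ((intertwiner W hħ hυ).symm f))) f ?_ ?_
  · exact isClosed_eq (schrodinger ħ g).continuous ((intertwiner W hħ hυ).continuous.comp
      ((doubled ħ υ g).continuous.comp (intertwiner W hħ hυ).symm.continuous))
  · intro u
    rw [intertwiner_symm_toLp, doubled_toLp, intertwiner_toLp, schrodinger_toLp,
      intertwinerSchwartz_doubledSchwartz, ContinuousLinearEquiv.apply_symm_apply]

end Intertwiner

/-! ### Matrix coefficients of the Schrödinger representation -/

section MatrixCoefficient

set_option linter.unusedSectionVars false

variable {W : Type} [NormedAddCommGroup W] [InnerProductSpace ℝ W]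

/-- The map `(x, t) ↦ (t - x, t)`. -/
def shear : (W × W) ≃L[ℝ] (W × W) :=
  ContinuousLinearEquiv.equivOfInverse
    ((ContinuousLinearMap.snd ℝ W W - ContinuousLinearMap.fst ℝ W W).prod
      (ContinuousLinearMap.snd ℝ W W))
    ((ContinuousLinearMap.snd ℝ W W - ContinuousLinearMap.fst ℝ W W).prod
      (ContinuousLinearMap.snd ℝ W W))
    (fun p => by ext <;> simp) (fun p => by ext <;> simp)

/-- The map `(x, y) ↦ (x, c y)`. -/
def scaleSnd (c : ℝ) (hc : c ≠ 0) : Dbl W ≃L[ℝ] (W × W) :=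
  (WithLp.prodContinuousLinearEquiv 2 ℝ W W).trans
    ((ContinuousLinearEquiv.refl ℝ W).prodCongr
      (ContinuousLinearEquiv.smulLeft (Units.mk0 c hc)))

theorem scaleSnd_apply (c : ℝ) (hc : c ≠ 0) (z : Dbl W) :
    scaleSnd c hc z = (z.fst, c • z.snd) := rfl

variable [FiniteDimensional ℝ W] [MeasurableSpace W] [BorelSpace W] {ħ : ℝ} (hħ : ħ ≠ 0)

/-- `g ↦ ((x, y) ↦ exp(π i ħ x y) ∫ exp(-2 π i ħ y t) g(x, t) dt)`. -/
def twistedPartialFourier : 𝓢(W × W, ℂ) →L[ℂ] 𝓢(Dbl W, ℂ) :=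
  (chirpEquiv (W := W) 1 one_ne_zero (Real.pi * ħ) : 𝓢(Dbl W, ℂ) →L[ℂ] 𝓢(Dbl W, ℂ)) ∘L
    compCLMOfContinuousLinearEquiv ℂ (scaleSnd ħ hħ) ∘L partialFourier

theorem twistedPartialFourier_apply (g : 𝓢(W × W, ℂ)) (z : Dbl W) :
    twistedPartialFourier hħ g z = ∫ t, Complex.exp ((Real.pi * ħ *
      (2 * 0 - 2 * ⟪z.snd, t⟫ + ⟪z.fst, z.snd⟫) : ℝ) * Complex.I) * g (z.fst, t) := by
  have h : twistedPartialFourier hħ g z =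
      chirp 1 (Real.pi * ħ) z * partialFourier g (scaleSnd ħ hħ z) :=
    chirpEquiv_apply 1 one_ne_zero _ _ z
  rw [h, partialFourier_apply, ← integral_const_mul]
  congr 1
  ext t
  rw [scaleSnd_apply, Circle.smul_def, Real.fourierChar_apply, smul_eq_mul, ← mul_assoc, chirp,
    one_mul, ← Complex.exp_add]
  congr 2
  rw [real_inner_smul_right, real_inner_comm z.snd t]
  push_cast
  ring

/-- The matrix coefficient `(x, y) ↦ ∫ (ρ_ħ(0, x, y) u)(t) v(t) dt`, as a function of `u`. -/
def coefficientLeft (v : 𝓢(W, ℂ)) : 𝓢(W, ℂ) →L[ℂ] 𝓢(Dbl W, ℂ) :=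
  twistedPartialFourier hħ ∘L compCLMOfContinuousLinearEquiv ℂ shear ∘L tensorCLM v

/-- The matrix coefficient `(x, y) ↦ ∫ (ρ_ħ(0, x, y) u)(t) v(t) dt`, as a function of `v`. -/
def coefficientRight (u : 𝓢(W, ℂ)) : 𝓢(W, ℂ) →L[ℂ] 𝓢(Dbl W, ℂ) :=
  twistedPartialFourier hħ ∘L
    compCLMOfContinuousLinearEquiv ℂ (shear.trans (ContinuousLinearEquiv.prodComm ℝ W W)) ∘L
      tensorCLM u

theorem coefficientLeft_apply (u v : 𝓢(W, ℂ)) (z : Dbl W) :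
    coefficientLeft hħ v u z = ∫ t, schrodingerFun ħ ⟨0, z.fst, z.snd⟩ u t * v t := by
  have h : coefficientLeft hħ v u z = twistedPartialFourier hħ
    (compCLMOfContinuousLinearEquiv ℂ shear (tensorCLM v u)) z := rfl
  rw [h, twistedPartialFourier_apply]
  congr 1
  ext t
  have h2 : compCLMOfContinuousLinearEquiv ℂ shear (tensorCLM v u) (z.fst, t) =
    u (t - z.fst) * v t := tensorCLM_apply _ _ _
  rw [h2, ← mul_assoc]
  rfl

theorem coefficientRight_apply (u v : 𝓢(W, ℂ)) (z : Dbl W) :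
    coefficientRight hħ u v z = ∫ t, schrodingerFun ħ ⟨0, z.fst, z.snd⟩ u t * v t := by
  have h : coefficientRight hħ u v z = twistedPartialFourier hħ
    (compCLMOfContinuousLinearEquiv ℂ (shear.trans (ContinuousLinearEquiv.prodComm ℝ W W))
      (tensorCLM u v)) z := rfl
  rw [h, twistedPartialFourier_apply]
  congr 1
  ext t
  have h2 : compCLMOfContinuousLinearEquiv ℂ
      (shear.trans (ContinuousLinearEquiv.prodComm ℝ W W)) (tensorCLM u v) (z.fst, t) =
    v t * u (t - z.fst) := tensorCLM_apply _ _ _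
  rw [h2, mul_comm (v t), ← mul_assoc]
  rfl

/-- One form is visibly linear and continuous in $u$, the other in $v$. Together they make the
integrated representation a continuous map into $\mathcal S'$ with its pointwise topology. -/
theorem coefficientLeft_eq_coefficientRight (u v : 𝓢(W, ℂ)) :
    coefficientLeft hħ v u = coefficientRight hħ u v := by
  ext z
  rw [coefficientLeft_apply, coefficientRight_apply]

/-- The integrated Schrödinger representation of a tempered distribution. -/
def integratedSchrodinger (b : 𝓢'(Dbl W, ℂ)) : 𝓢(W, ℂ) →L[ℂ] 𝓢'(W, ℂ) where
  toFun u := PointwiseConvergenceCLM.precomp ℂ (coefficientRight hħ u) b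
  map_add' u u' := by
    ext v
    change b (coefficientRight hħ (u + u') v) =
      b (coefficientRight hħ u v) + b (coefficientRight hħ u' v)
    simp only [← coefficientLeft_eq_coefficientRight, map_add]
  map_smul' c u := by
    ext v
    change b (coefficientRight hħ (c • u) v) = c • b (coefficientRight hħ u v)
    simp only [← coefficientLeft_eq_coefficientRight, map_smul]
  cont := by
    refine PointwiseConvergenceCLM.continuous_of_continuous_eval fun v => ?_
    change Continuous fun u => b (coefficientRight hħ u v)
    simp only [← coefficientLeft_eq_coefficientRight]
    exact b.continuous.comp (coefficientLeft hħ v).continuous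

end MatrixCoefficient

/-! ### Two-sided convolutions with distributional kernels -/

section TwoSided

set_option linter.unusedSectionVars false

variable {W : Type} [NormedAddCommGroup W] [InnerProductSpace ℝ W] [FiniteDimensional ℝ W]
  [MeasurableSpace W] [BorelSpace W]

variable {ħ υ : ℝ} (hħ : ħ ≠ 0) (hυ : υ ≠ 0)

/-- The kernel `k ∘ B` on the doubled Heisenberg group. -/
def rearrangeDist (k : 𝓢'(Dbl (Dbl W), ℂ)) : 𝓢'(Dbl (Dbl W), ℂ) :=
  PointwiseConvergenceCLM.precomp ℂ
    (compCLMOfContinuousLinearEquiv ℂ (rearrange (W := W) υ hυ).symm) k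

theorem isWeylPDO_integratedSchrodinger (k : 𝓢'(Dbl (Dbl W), ℂ)) :
    IsWeylPDO ħ hħ (symbolDist (W := W) ħ υ hħ hυ k)
      (integratedSchrodinger (W := Dbl W) hħ (rearrangeDist (W := W) hυ k)) := fun u v =>
  ⟨coefficientRight hħ u v, coefficientRight_apply hħ u v,
    (symbolDist_fourierAlong ħ υ hħ hυ k _).symm⟩

/-- The matrix coefficients of the two-sided representation. -/
def coefficientTwo (u v : 𝓢(Dbl W, ℂ)) : 𝓢(Dbl (Dbl W), ℂ) :=
  compCLMOfContinuousLinearEquiv ℂ (rearrange (W := W) υ hυ).symm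
    (coefficientRight hħ (intertwinerSchwartz W hħ hυ u) ((intertwinerTranspose W hħ hυ).symm v))

theorem doubledSchwartz_rearrange_symm (u : 𝓢(Dbl W, ℂ)) (p : Dbl (Dbl W)) (z : Dbl W) :
    doubledSchwartz ħ υ ⟨0, ((rearrange υ hυ).symm p).fst, ((rearrange υ hυ).symm p).snd⟩ u z =
      leftFun ħ ⟨0, p.fst.fst, p.fst.snd⟩ (rightFun ħ ⟨0, p.snd.fst, p.snd.snd⟩ u) z := by
  obtain ⟨q, rfl⟩ := (rearrange (W := W) υ hυ).surjective p
  rw [ContinuousLinearEquiv.symm_apply_apply, doubledSchwartz, ContinuousLinearMap.comp_apply,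
    leftSchwartz_apply]
  congr 1
  ext z
  exact rightSchwartz_apply _ _ _ _

/-- The intertwining relation moves $\rho_\hbar$ inside $U$; transposition then moves $U$ onto the
second function, where it cancels the inverse transpose. -/
theorem coefficientTwo_apply (u v : 𝓢(Dbl W, ℂ)) (p : Dbl (Dbl W)) :
    coefficientTwo hħ hυ u v p = ∫ z, leftFun ħ ⟨0, p.fst.fst, p.fst.snd⟩
      (rightFun ħ ⟨0, p.snd.fst, p.snd.snd⟩ u) z * v z := by
  have h : coefficientTwo hħ hυ u v p = coefficientRight hħ (intertwinerSchwartz W hħ hυ u)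
    ((intertwinerTranspose W hħ hυ).symm v) ((rearrange υ hυ).symm p) := rfl
  rw [h, coefficientRight_apply]
  simp only [← schrodingerSchwartz_apply, ← intertwinerSchwartz_doubledSchwartz hħ hυ]
  rw [integral_intertwinerSchwartz_mul, ContinuousLinearEquiv.apply_symm_apply]
  simp only [doubledSchwartz_rearrange_symm hυ u p]

/-- The two-sided convolution with a distributional kernel. -/
def twoSidedConvDist (k : 𝓢'(Dbl (Dbl W), ℂ)) : 𝓢(Dbl W, ℂ) →L[ℂ] 𝓢'(Dbl W, ℂ) :=
  ((intertwinerDist W hħ hυ).symm : 𝓢'(Dbl W, ℂ) →L[ℂ] 𝓢'(Dbl W, ℂ)) ∘L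
    integratedSchrodinger (W := Dbl W) hħ (rearrangeDist (W := W) hυ k) ∘L
      (intertwinerSchwartz W hħ hυ : 𝓢(Dbl W, ℂ) →L[ℂ] 𝓢(Dbl W, ℂ))

theorem isTwoSidedConvDist_twoSidedConvDist (k : 𝓢'(Dbl (Dbl W), ℂ)) :
    IsTwoSidedConvDist ħ k (twoSidedConvDist hħ hυ k) := fun u v =>
  ⟨coefficientTwo hħ hυ u v, coefficientTwo_apply hħ hυ u v, rfl⟩

theorem intertwinerDist_twoSidedConvDist (k : 𝓢'(Dbl (Dbl W), ℂ)) (u : 𝓢(Dbl W, ℂ)) :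
    intertwinerDist W hħ hυ (twoSidedConvDist hħ hυ k ((intertwinerSchwartz W hħ hυ).symm u)) =
      integratedSchrodinger (W := Dbl W) hħ (rearrangeDist (W := W) hυ k) u := by
  change intertwinerDist W hħ hυ ((intertwinerDist W hħ hυ).symm
    (integratedSchrodinger (W := Dbl W) hħ (rearrangeDist (W := W) hυ k)
      (intertwinerSchwartz W hħ hυ ((intertwinerSchwartz W hħ hυ).symm u)))) = _
  rw [ContinuousLinearEquiv.apply_symm_apply, ContinuousLinearEquiv.apply_symm_apply]

end TwoSided

/-! ### Weak integrals of families of contractions -/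

section WeakIntegral

theorem integrable_mul_inner {X H : Type*} [MeasureSpace X] [NormedAddCommGroup H]
    [InnerProductSpace ℂ H] {k : X → ℂ} {π : X → H →L[ℂ] H} (hk : Integrable k)
    (hπ : ∀ f g : H, AEStronglyMeasurable fun x => inner ℂ g (π x f))
    (hn : ∀ x f, ‖π x f‖ ≤ ‖f‖) (f g : H) : Integrable fun x => k x * inner ℂ g (π x f) :=
  hk.mul_bdd (c := ‖g‖ * ‖f‖) (hπ f g) (Filter.Eventually.of_forall fun x =>
    (norm_inner_le_norm _ _).trans (mul_le_mul_of_nonneg_left (hn x f) (norm_nonneg _)))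

/-- The weak integral of an integrable kernel against a family of contractions exists. -/
theorem exists_isWeakIntegral {X H : Type*} [MeasureSpace X] [NormedAddCommGroup H]
    [InnerProductSpace ℂ H] [CompleteSpace H] {k : X → ℂ} {π : X → H →L[ℂ] H} (hk : Integrable k)
    (hπ : ∀ f g : H, AEStronglyMeasurable fun x => inner ℂ g (π x f))
    (hn : ∀ x f, ‖π x f‖ ≤ ‖f‖) : ∃ T : H →L[ℂ] H, IsWeakIntegral k π T := by
  have hint := integrable_mul_inner hk hπ hn
  let B : H →ₗ⋆[ℂ] H →ₗ[ℂ] ℂ := LinearMap.mk₂'ₛₗ (starRingEnd ℂ) (RingHom.id ℂ)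
    (fun g f => ∫ x, k x * inner ℂ g (π x f))
    (fun g g' f => by
      simp only [inner_add_left, mul_add]
      exact integral_add (hint f g) (hint f g'))
    (fun c g f => by
      simp only [inner_smul_left, mul_left_comm (k _)]
      exact integral_const_mul _ _)
    (fun g f f' => by
      simp only [map_add, inner_add_right, mul_add]
      exact integral_add (hint f g) (hint f' g))
    (fun c g f => by
      simp only [map_smul, inner_smul_right, mul_left_comm (k _)]
      exact integral_const_mul _ _)
  have hB : ∀ g f, ‖B g f‖ ≤ (∫ x, ‖k x‖) * ‖g‖ * ‖f‖ := by
    intro g f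
    change ‖∫ x, k x * inner ℂ g (π x f)‖ ≤ _
    rw [mul_assoc, ← integral_mul_const]
    refine norm_integral_le_of_norm_le (hk.norm.mul_const _) (Filter.Eventually.of_forall fun x => ?_)
    rw [norm_mul]
    exact mul_le_mul_of_nonneg_left ((norm_inner_le_norm _ _).trans
      (mul_le_mul_of_nonneg_left (hn x f) (norm_nonneg _))) (norm_nonneg _)
  -- The representing operator satisfies $\langle Sg,f\rangle=B(g,f)$, so the weak integral is its
  -- adjoint.
  let S := InnerProductSpace.continuousLinearMapOfBilin (B.mkContinuous₂ _ hB)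
  refine ⟨ContinuousLinearMap.adjoint S, fun f g => ⟨hint f g, ?_⟩⟩
  rw [ContinuousLinearMap.adjoint_inner_right]
  exact InnerProductSpace.continuousLinearMapOfBilin_apply _ _ _

end WeakIntegral

/-! ### Two-sided convolutions with integrable kernels -/

section Integrable

set_option linter.unusedSectionVars false

/-- The complex conjugate of a Schwartz function. -/
def conjSchwartz {E : Type*} [NormedAddCommGroup E] [NormedSpace ℝ E] (u : 𝓢(E, ℂ)) : 𝓢(E, ℂ) :=
  SchwartzMap.postcompCLM (𝕜 := ℝ) (Complex.conjCLE : ℂ →L[ℝ] ℂ) u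

theorem conjSchwartz_apply {E : Type*} [NormedAddCommGroup E] [NormedSpace ℝ E] (u : 𝓢(E, ℂ))
    (x : E) : conjSchwartz u x = starRingEnd ℂ (u x) := rfl

variable {W : Type} [NormedAddCommGroup W] [InnerProductSpace ℝ W] [FiniteDimensional ℝ W]
  [MeasurableSpace W] [BorelSpace W]

/-- Passes between the sesquilinear pairing of weak integrals and the bilinear pairing of
distributions. -/
theorem inner_conjSchwartz_toLp (f : L2 W) (v : 𝓢(W, ℂ)) :
    inner ℂ ((conjSchwartz v).toLp 2 : L2 W) f = Lp.toTemperedDistribution f v := by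
  rw [Lp.toTemperedDistribution_apply, L2.inner_def]
  refine integral_congr_ae ?_
  filter_upwards [(conjSchwartz v).coeFn_toLp 2] with x hx
  rw [hx, conjSchwartz_apply, RCLike.inner_apply, RingHomCompTriple.comp_apply]
  simp [mul_comm]

theorem norm_phaseShift_apply_le (θ : W → ℝ) (hθ : Continuous θ) (a : W) (f : L2 W) :
    ‖phaseShift θ hθ a f‖ ≤ ‖f‖ := by
  have h := (phaseShift θ hθ a).le_of_opNorm_le
    (LinearMap.mkContinuous_norm_le _ zero_le_one _) f
  rwa [one_mul] at h

theorem norm_left_apply_le (ħ : ℝ) (g : Heis W) (f : L2 (Dbl W)) : ‖left ħ g f‖ ≤ ‖f‖ :=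
  norm_phaseShift_apply_le _ _ _ f

theorem norm_right_apply_le (ħ : ℝ) (g : Heis W) (f : L2 (Dbl W)) : ‖right ħ g f‖ ≤ ‖f‖ :=
  norm_phaseShift_apply_le _ _ _ f

theorem norm_leftRight_apply_le (ħ : ℝ) (p : Dbl (Dbl W)) (f : L2 (Dbl W)) :
    ‖leftRight ħ p f‖ ≤ ‖f‖ :=
  (norm_left_apply_le ħ _ _).trans (norm_right_apply_le ħ _ f)

variable {ħ υ : ℝ} (hħ : ħ ≠ 0) (hυ : υ ≠ 0)

theorem inner_leftRight_toLp (u v : 𝓢(Dbl W, ℂ)) (p : Dbl (Dbl W)) :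
    inner ℂ ((conjSchwartz v).toLp 2 : L2 (Dbl W)) (leftRight ħ p (u.toLp 2)) =
      coefficientTwo hħ hυ u v p := by
  rw [inner_conjSchwartz_toLp, leftRight, ContinuousLinearMap.comp_apply, right_toLp, left_toLp,
    Lp.toTemperedDistribution_toLp_eq,
    toTemperedDistributionCLM_apply_apply (volume : Measure (Dbl W)), coefficientTwo_apply]
  congr 1
  ext z
  rw [smul_eq_mul, mul_comm, leftSchwartz_apply]
  congr 2
  ext z
  exact rightSchwartz_apply _ _ _ _

/-- For Schwartz $f$ and $g$ the coefficient is itself Schwartz, hence continuous; the general one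
is a pointwise limit of such coefficients. -/
theorem aestronglyMeasurable_inner_leftRight (hħ : ħ ≠ 0) (f g : L2 (Dbl W)) :
    AEStronglyMeasurable fun p : Dbl (Dbl W) => (inner ℂ g (leftRight ħ p f) : ℂ) := by
  obtain ⟨a, ha, hf⟩ := mem_closure_iff_seq_limit.mp (denseRange_toLp f)
  obtain ⟨b, hb, hg⟩ := mem_closure_iff_seq_limit.mp (denseRange_toLp g)
  choose u hu using ha
  choose v hv using hb
  refine aestronglyMeasurable_of_tendsto_ae Filter.atTop
    (f := fun n p => (inner ℂ (b n) (leftRight ħ p (a n)) : ℂ)) (fun n => ?_)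
    (Filter.Eventually.of_forall fun p => ?_)
  · have h : (fun p => (inner ℂ (b n) (leftRight ħ p (a n)) : ℂ)) =
        -- The values of `coefficientTwo` do not depend on $\upsilon$, so $\upsilon=1$ serves.
        coefficientTwo hħ one_ne_zero (u n) (conjSchwartz (v n)) := by
      ext p
      rw [← inner_leftRight_toLp, ← hu, ← hv]
      congr 3
      ext z
      simp [conjSchwartz_apply]
    rw [h]
    exact (SchwartzMap.continuous _).aestronglyMeasurable
  · exact hg.inner (((leftRight ħ p).continuous.tendsto f).comp hf)

theorem exists_isTwoSidedConv (hħ : ħ ≠ 0) {k : Dbl (Dbl W) → ℂ} (hk : Integrable k) :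
    ∃ D, IsTwoSidedConv ħ k D :=
  exists_isWeakIntegral hk (aestronglyMeasurable_inner_leftRight hħ) (norm_leftRight_apply_le ħ)

/-- The tempered distribution defined by an integrable function. -/
def integrableDist {E : Type*} [NormedAddCommGroup E] [InnerProductSpace ℝ E]
    [FiniteDimensional ℝ E] [MeasurableSpace E] [BorelSpace E] {k : E → ℂ} (hk : Integrable k) :
    𝓢'(E, ℂ) :=
  Lp.toTemperedDistribution ((memLp_one_iff_integrable.mpr hk).toLp k)

theorem integrableDist_apply {E : Type*} [NormedAddCommGroup E] [InnerProductSpace ℝ E]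
    [FiniteDimensional ℝ E] [MeasurableSpace E] [BorelSpace E] {k : E → ℂ} (hk : Integrable k)
    (φ : 𝓢(E, ℂ)) : integrableDist hk φ = ∫ x, k x * φ x := by
  rw [integrableDist, Lp.toTemperedDistribution_apply]
  refine integral_congr_ae ?_
  filter_upwards [(memLp_one_iff_integrable.mpr hk).coeFn_toLp] with x hx
  rw [hx, smul_eq_mul, mul_comm]

theorem toTemperedDistribution_twoSidedConv {k : Dbl (Dbl W) → ℂ} (hk : Integrable k)
    {D : L2 (Dbl W) →L[ℂ] L2 (Dbl W)} (hD : IsTwoSidedConv ħ k D) (u : 𝓢(Dbl W, ℂ)) :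
    (Lp.toTemperedDistribution (D (u.toLp 2)) : 𝓢'(Dbl W, ℂ)) =
      twoSidedConvDist hħ hυ (integrableDist hk) u := by
  ext v
  have h : twoSidedConvDist hħ hυ (integrableDist hk) u v =
    integrableDist hk (coefficientTwo hħ hυ u v) := rfl
  rw [h, integrableDist_apply, ← inner_conjSchwartz_toLp, (hD _ _).2]
  simp only [inner_leftRight_toLp hħ hυ]

theorem toTemperedDistribution_intertwiner_twoSidedConv {k : Dbl (Dbl W) → ℂ} (hk : Integrable k)
    {D : L2 (Dbl W) →L[ℂ] L2 (Dbl W)} (hD : IsTwoSidedConv ħ k D) (u : 𝓢(Dbl W, ℂ)) :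
    (Lp.toTemperedDistribution (intertwiner W hħ hυ
        (D ((intertwiner W hħ hυ).symm (u.toLp 2)))) : 𝓢'(Dbl W, ℂ)) =
      integratedSchrodinger (W := Dbl W) hħ (rearrangeDist (W := W) hυ (integrableDist hk)) u := by
  rw [← intertwinerDist_toTemperedDistribution, intertwiner_symm_toLp,
    toTemperedDistribution_twoSidedConv hħ hυ hk hD, intertwinerDist_twoSidedConvDist]

/-- The multiplication formula again, now between $k\in L^1$ and a Schwartz function: the transform
defined by duality agrees with the integral formula. -/
theorem symbolDist_integrableDist {k : Dbl (Dbl W) → ℂ} (hk : Integrable k)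
    (φ : 𝓢(Dbl (Dbl W), ℂ)) :
    symbolDist (W := W) ħ υ hħ hυ (integrableDist hk) φ = ∫ q, symbolFun ħ υ hυ k q * φ q := by
  let ψ : 𝓢(Dbl (Dbl W), ℂ) := compCLMOfContinuousLinearEquiv ℂ (rearrange (W := W) υ hυ).symm φ
  have h1 : symbolDist (W := W) ħ υ hħ hυ (integrableDist hk) φ = integrableDist hk
    (fourierAlong (rotateTwo (ħ / 2) (div_ne_zero hħ two_ne_zero))
      (2 * Module.finrank ℝ W) ħ ψ) := rfl
  have h2 := integral_comp_rearrange υ hυ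
    fun p => fourierFun sympFormTwo (2 * Module.finrank ℝ W) ħ k p * ψ p
  have h3 : ∀ q, ψ (rearrange υ hυ q) = φ q := fun q =>
    congrArg φ ((rearrange υ hυ).symm_apply_apply q)
  simp only [h3] at h2
  change _ = ∫ q, fourierFun sympFormTwo (2 * Module.finrank ℝ W) ħ k (rearrange υ hυ q) * φ q
  rw [h1, integrableDist_apply, h2]
  -- The factor $-\hbar/2$ turns the character $e^{-2\pi iL(p,p')}$ into $e^{\pi
  -- i\hbar\,\Omega(p,p')}$.
  let J := rotateTwo (W := W) (-(ħ / 2)) (neg_ne_zero.mpr (div_ne_zero hħ two_ne_zero))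
  let L : Dbl (Dbl W) →ₗ[ℝ] Dbl (Dbl W) →ₗ[ℝ] ℝ :=
    (innerₗ (Dbl (Dbl W))).compl₂ (J : Dbl (Dbl W) →ₗ[ℝ] Dbl (Dbl W))
  have hL : Continuous fun p : Dbl (Dbl W) × Dbl (Dbl W) => L p.1 p.2 := by
    change Continuous fun p : Dbl (Dbl W) × Dbl (Dbl W) => ⟪p.1, J p.2⟫
    exact continuous_fst.inner (J.continuous.comp continuous_snd)
  have key := VectorFourier.integral_fourierIntegral_smul_eq_flip (μ := volume) (ν := volume)
    (L := L) Real.continuous_fourierChar hL hk ψ.integrable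
  have h4 : ∀ (p p' : Dbl (Dbl W)) (c : ℂ), Real.fourierChar (-L p p') • c =
      c * Complex.exp ((Real.pi * ħ * sympFormTwo p p' : ℝ) * Complex.I) := by
    intro p p' c
    have h5 : L p p' = -(ħ / 2) * sympFormTwo p p' := inner_rotateTwo _ _ _ _
    rw [Circle.smul_def, Real.fourierChar_apply, smul_eq_mul, mul_comm, h5]
    congr 3
    push_cast
    ring
  have h6 : ∀ p', VectorFourier.fourierIntegral Real.fourierChar volume L k p' =
      ∫ p, k p * Complex.exp ((Real.pi * ħ * sympFormTwo p p' : ℝ) * Complex.I) := fun p' =>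
    integral_congr_ae (Filter.Eventually.of_forall fun p => h4 p p' _)
  have h7 : ∀ p, VectorFourier.fourierIntegral Real.fourierChar volume L.flip ψ p =
      ∫ p', ψ p' * Complex.exp ((Real.pi * ħ * sympFormTwo p p' : ℝ) * Complex.I) := fun p =>
    integral_congr_ae (Filter.Eventually.of_forall fun p' => h4 p p' _)
  simp only [h6, h7, smul_eq_mul] at key
  have h8 : ∀ p, k p * fourierAlong (rotateTwo (ħ / 2) (div_ne_zero hħ two_ne_zero))
      (2 * Module.finrank ℝ W) ħ ψ p = ((ħ / 2 : ℝ) : ℂ) ^ (2 * Module.finrank ℝ W) *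
        (k p * ∫ p', ψ p' * Complex.exp ((Real.pi * ħ * sympFormTwo p p' : ℝ) * Complex.I)) := by
    intro p
    rw [fourierAlong_rotateTwo_apply ħ hħ, mul_left_comm]
  have h9 : ∀ p', fourierFun sympFormTwo (2 * Module.finrank ℝ W) ħ k p' * ψ p' =
      ((ħ / 2 : ℝ) : ℂ) ^ (2 * Module.finrank ℝ W) * ((∫ p, k p *
        Complex.exp ((Real.pi * ħ * sympFormTwo p p' : ℝ) * Complex.I)) * ψ p') := fun p' =>
    mul_assoc _ _ _
  simp only [h8, h9]
  rw [integral_const_mul, integral_const_mul, key]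

end Integrable

/-! ### Weyl operators with Schwartz symbols -/

section Weyl

set_option linter.unusedSectionVars false

variable {W : Type} [NormedAddCommGroup W] [InnerProductSpace ℝ W] [FiniteDimensional ℝ W]
  [MeasurableSpace W] [BorelSpace W]

theorem integral_dbl {f : Dbl W → ℂ} (hf : Integrable f) : ∫ q, f q = ∫ x, ∫ y, f (pt x y) := by
  have hp := WithLp.volume_preserving_toLp W W
  have he := (MeasurableEquiv.toLp 2 (W × W)).measurableEmbedding
  have h1 : Integrable (fun p : W × W => f (WithLp.toLp 2 p)) :=
    (hp.integrable_comp_emb he).mpr hf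
  rw [← hp.integral_comp he f]
  exact integral_prod _ h1

theorem sympForm_pt (x y x' y' : W) : sympForm (pt x y) (pt x' y') = ⟪x, y'⟫ - ⟪x', y⟫ := rfl

/-- The Schwartz function `x ↦ ∫ K(x, y) exp(-π i ħ y X) dy`. -/
def partialSymbol (ħ : ℝ) (K : 𝓢(Dbl W, ℂ)) (X : W) : 𝓢(W, ℂ) :=
  slice ((ħ / 2) • X) (compCLMOfContinuousLinearEquiv ℂ (ContinuousLinearEquiv.prodComm ℝ W W)
    (partialFourier (compCLMOfContinuousLinearEquiv ℂ
      (WithLp.prodContinuousLinearEquiv 2 ℝ W W).symm K)))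

theorem partialSymbol_apply (ħ : ℝ) (K : 𝓢(Dbl W, ℂ)) (X x : W) :
    partialSymbol ħ K X x =
      ∫ y, K (pt x y) * Complex.exp ((-(Real.pi * ħ * ⟪y, X⟫) : ℝ) * Complex.I) := by
  have h : partialSymbol ħ K X x = partialFourier (compCLMOfContinuousLinearEquiv ℂ
      (WithLp.prodContinuousLinearEquiv 2 ℝ W W).symm K) (x, (ħ / 2) • X) := rfl
  rw [h, partialFourier_apply]
  congr 1
  ext y
  rw [Circle.smul_def, Real.fourierChar_apply, smul_eq_mul, mul_comm]
  have h2 : compCLMOfContinuousLinearEquiv ℂ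
      (WithLp.prodContinuousLinearEquiv 2 ℝ W W).symm K (x, y) = K (pt x y) := rfl
  rw [h2, real_inner_smul_right]
  congr 3
  push_cast
  ring

theorem integrable_mul_cexp {E : Type*} [NormedAddCommGroup E] [MeasureSpace E] [BorelSpace E]
    [SecondCountableTopology E] {K : E → ℂ} (hK : Integrable K) {θ : E → ℝ} (hθ : Continuous θ) :
    Integrable fun q => K q * Complex.exp (θ q * Complex.I) := by
  refine hK.mul_bdd (c := 1) ?_ (Filter.Eventually.of_forall fun q => ?_)
  · exact (by fun_prop : Continuous fun q => Complex.exp (θ q * Complex.I)).aestronglyMeasurable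
  · rw [Complex.norm_exp_ofReal_mul_I]

theorem continuous_fst_dbl : Continuous fun z : Dbl W => z.fst :=
  (WithLp.fstL 2 ℝ W W).continuous

theorem continuous_snd_dbl : Continuous fun z : Dbl W => z.snd :=
  (WithLp.sndL 2 ℝ W W).continuous

/-- The phase $x\xi-Xy$ separates: the $y$-integral gives `partialSymbol`, and the $x$-integral is
an inverse Fourier transform at frequency $(\hbar/2)\xi$. -/
theorem fourierFun_sympForm_pt (ħ : ℝ) (N : ℕ) (K : 𝓢(Dbl W, ℂ)) (X ξ : W) :
    fourierFun sympForm N ħ K (pt X ξ) =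
      ((ħ / 2 : ℝ) : ℂ) ^ N * 𝓕⁻ (partialSymbol ħ K X) ((ħ / 2) • ξ) := by
  rw [fourierFun, fourierInv_coe, Real.fourierInv_eq']
  congr 1
  have h1 : Continuous fun z : Dbl W => Real.pi * ħ * sympForm z (pt X ξ) := by
    have h2 := continuous_fst_dbl (W := W)
    have h3 := continuous_snd_dbl (W := W)
    simp only [sympForm, pt_fst, pt_snd]
    fun_prop
  rw [integral_dbl (integrable_mul_cexp K.integrable h1)]
  congr 1
  ext x
  rw [partialSymbol_apply, smul_eq_mul, ← integral_const_mul]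
  congr 1
  ext y
  rw [mul_left_comm, ← Complex.exp_add]
  congr 2
  rw [sympForm_pt, real_inner_smul_right, real_inner_comm y X]
  push_cast
  ring

/-- Inversion of the Fourier transform of a symbol in its second variable. -/
theorem integral_fourierFun_sympForm_mul {ħ : ℝ} (hħ : ħ ≠ 0) {N : ℕ}
    (hN : N = Module.finrank ℝ W) (he : Even N) (K : 𝓢(Dbl W, ℂ)) (X x : W) :
    ∫ ξ, fourierFun sympForm N ħ K (pt X ξ) *
      Complex.exp ((-(Real.pi * ħ * ⟪ξ, x⟫) : ℝ) * Complex.I) = partialSymbol ħ K X x := by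
  set H := partialSymbol ħ K X
  let Φ : W → ℂ := fun η => Complex.exp ((-2 * Real.pi * ⟪η, x⟫ : ℝ) * Complex.I) • 𝓕⁻ H η
  have h1 : ∀ ξ, fourierFun sympForm N ħ K (pt X ξ) *
      Complex.exp ((-(Real.pi * ħ * ⟪ξ, x⟫) : ℝ) * Complex.I) =
        ((ħ / 2 : ℝ) : ℂ) ^ N * Φ ((ħ / 2) • ξ) := by
    intro ξ
    rw [fourierFun_sympForm_pt, mul_assoc, mul_comm (𝓕⁻ (partialSymbol ħ K X) _)]
    change _ = _ * (Complex.exp ((-2 * Real.pi * ⟪(ħ / 2) • ξ, x⟫ : ℝ) * Complex.I) *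
      𝓕⁻ H ((ħ / 2) • ξ))
    rw [real_inner_smul_left]
    congr 4
    push_cast
    ring
  have h2 : ∫ η, Φ η = H x := by
    rw [← Real.fourier_eq', ← fourier_coe, FourierTransform.fourier_fourierInv_eq]
  simp_rw [h1]
  -- The scaling contributes $|(\hbar/2)^N|^{-1}$. For even $N$ this cancels $(\hbar/2)^N$ whatever
  -- the sign of $\hbar$.
  rw [integral_const_mul, Measure.integral_comp_smul, h2, ← hN, abs_of_nonneg (inv_nonneg.mpr (he.pow_nonneg _)),
    Complex.real_smul, ← mul_assoc]
  push_cast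
  rw [mul_inv_cancel₀, one_mul]
  exact pow_ne_zero _ (div_ne_zero (Complex.ofReal_ne_zero.mpr hħ) two_ne_zero)

theorem norm_schrodingerFun (ħ : ℝ) (g : Heis W) (u : W → ℂ) (t : W) :
    ‖schrodingerFun ħ g u t‖ = ‖u (t - g.x)‖ := by
  rw [schrodingerFun, norm_mul, Complex.norm_exp_ofReal_mul_I, one_mul]

theorem continuous_schrodingerFun (ħ : ℝ) (u : 𝓢(W, ℂ)) :
    Continuous fun p : Dbl W × W => schrodingerFun ħ ⟨0, p.1.fst, p.1.snd⟩ u p.2 := by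
  have h2 := (continuous_fst_dbl (W := W)).comp (continuous_fst (X := Dbl W) (Y := W))
  have h3 := (continuous_snd_dbl (W := W)).comp (continuous_fst (X := Dbl W) (Y := W))
  have h4 := u.continuous
  simp only [Function.comp_def] at h2 h3
  simp only [schrodingerFun]
  fun_prop

/-- The function `t ↦ ∫ K(x, y) (ρ_ħ(0, x, y) u)(t) dx dy`. -/
def weylFun (ħ : ℝ) (K : Dbl W → ℂ) (u : W → ℂ) (t : W) : ℂ :=
  ∫ q, K q * schrodingerFun ħ ⟨0, q.fst, q.snd⟩ u t

theorem exists_norm_schrodingerFun_le (u : 𝓢(W, ℂ)) :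
    ∃ C, 0 ≤ C ∧ ∀ ħ g t, ‖schrodingerFun ħ g u t‖ ≤ C := by
  obtain ⟨C, hC⟩ := u.toBoundedContinuousFunction.isBounded_range.exists_norm_le
  refine ⟨C, (norm_nonneg _).trans (hC _ (Set.mem_range_self 0)), fun ħ g t => ?_⟩
  rw [norm_schrodingerFun]
  exact hC _ (Set.mem_range_self (t - g.x))

/-- The function is bounded by $\|K\|_1\sup|u|$. Local integrability is what the passage from weak
to almost-everywhere equality asks for. -/
theorem locallyIntegrable_weylFun (ħ : ℝ) {K : Dbl W → ℂ} (hK : Integrable K) (u : 𝓢(W, ℂ)) :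
    LocallyIntegrable (weylFun ħ K u) := by
  obtain ⟨C, hC0, hC⟩ := exists_norm_schrodingerFun_le u
  refine MemLp.locallyIntegrable (p := ∞) (memLp_top_of_bound ?_ (∫ q, ‖K q‖ * C)
    (Filter.Eventually.of_forall fun t => ?_)) le_top
  · have h : AEStronglyMeasurable (fun p : W × Dbl W =>
        K p.2 * schrodingerFun ħ ⟨0, p.2.fst, p.2.snd⟩ u p.1)
        ((volume : Measure W).prod (volume : Measure (Dbl W))) :=
      hK.aestronglyMeasurable.comp_snd.mul
        ((continuous_schrodingerFun ħ u).comp continuous_swap).aestronglyMeasurable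
    exact h.integral_prod_right'
  · refine norm_integral_le_of_norm_le (hK.norm.mul_const C) (Filter.Eventually.of_forall fun q => ?_)
    rw [norm_mul]
    exact mul_le_mul_of_nonneg_left (hC _ _ _) (norm_nonneg _)

theorem integral_mul_coefficientRight {ħ : ℝ} (hħ : ħ ≠ 0) {K : Dbl W → ℂ} (hK : Integrable K)
    (u v : 𝓢(W, ℂ)) :
    ∫ q, K q * coefficientRight hħ u v q = ∫ t, weylFun ħ K u t * v t := by
  obtain ⟨C, hC0, hC⟩ := exists_norm_schrodingerFun_le u
  have h : Integrable (fun p : Dbl W × W =>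
      (K p.1 * v p.2) * schrodingerFun ħ ⟨0, p.1.fst, p.1.snd⟩ u p.2)
      ((volume : Measure (Dbl W)).prod (volume : Measure W)) :=
    (hK.mul_prod v.integrable).mul_bdd (continuous_schrodingerFun ħ u).aestronglyMeasurable
      (Filter.Eventually.of_forall fun p => hC _ _ _)
  have key := integral_integral_swap (f := fun q t =>
    (K q * v t) * schrodingerFun ħ ⟨0, q.fst, q.snd⟩ u t) h
  calc _ = ∫ q, ∫ t, (K q * v t) * schrodingerFun ħ ⟨0, q.fst, q.snd⟩ u t := by
        congr 1
        ext q
        rw [coefficientRight_apply, ← integral_const_mul]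
        congr 1
        ext t
        ring
    _ = ∫ t, ∫ q, (K q * v t) * schrodingerFun ħ ⟨0, q.fst, q.snd⟩ u t := key
    _ = _ := by
        congr 1
        ext t
        rw [weylFun, ← integral_mul_const]
        congr 1
        ext q
        ring

/-- Under $x=t-r$ the Schrödinger phase $-2yt+xy$ becomes $-y(t+r)$, which is where the argument
$t+r$ of the symbol comes from. -/
theorem weylFun_eq_integral (ħ : ℝ) (K : 𝓢(Dbl W, ℂ)) (u : 𝓢(W, ℂ)) (t : W) :
    weylFun ħ K u t = ∫ r, partialSymbol ħ K (t + r) (t - r) * u r := by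
  obtain ⟨C, hC0, hC⟩ := exists_norm_schrodingerFun_le u
  have hi : Integrable fun q : Dbl W => K q * schrodingerFun ħ ⟨0, q.fst, q.snd⟩ u t :=
    K.integrable.mul_bdd ((continuous_schrodingerFun ħ u).comp
      (Continuous.prodMk_left t)).aestronglyMeasurable (Filter.Eventually.of_forall fun p => hC _ _ _)
  rw [weylFun, integral_dbl hi, ← integral_sub_left_eq_self _ volume t]
  congr 1
  ext r
  rw [partialSymbol_apply, ← integral_mul_const]
  congr 1
  ext y
  rw [schrodingerFun, ← mul_assoc]
  simp only [sub_sub_cancel, pt_fst, pt_snd]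
  congr 3
  rw [inner_add_right, real_inner_comm y (t - r), inner_sub_right]
  congr 2
  ring

/-- Smooth compactly supported functions are Schwartz and suffice to separate locally integrable
functions. -/
theorem ae_eq_of_toTemperedDistribution {f : L2 W} {G : W → ℂ} (hG : LocallyIntegrable G)
    (h : ∀ v : 𝓢(W, ℂ), (Lp.toTemperedDistribution f : 𝓢'(W, ℂ)) v = ∫ t, G t * v t) :
    ∀ᵐ t, f t = G t := by
  refine ae_eq_of_integral_contDiff_smul_eq ((Lp.memLp f).locallyIntegrable one_le_two) hG ?_
  intro g hg hs
  have hs' : HasCompactSupport (Complex.ofRealCLM ∘ g) := hs.comp_left rfl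
  have hg' : ContDiff ℝ (⊤ : ℕ∞) (Complex.ofRealCLM ∘ g) := Complex.ofRealCLM.contDiff.comp hg
  have h1 := h (hs'.toSchwartzMap hg')
  rw [Lp.toTemperedDistribution_apply] at h1
  have h2 : ∀ t, hs'.toSchwartzMap hg' t = (g t : ℂ) := fun t => rfl
  simp only [h2, smul_eq_mul] at h1
  simp only [Complex.real_smul]
  rw [h1]
  congr 1
  ext t
  ring

end Weyl

/-! ### Integral formula for Schwartz kernels -/

section SchwartzKernel

variable {W : Type} [NormedAddCommGroup W] [InnerProductSpace ℝ W] [FiniteDimensional ℝ W]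
  [MeasurableSpace W] [BorelSpace W]

variable {ħ υ : ℝ} (hħ : ħ ≠ 0) (hυ : υ ≠ 0)

theorem symbolFun_eq_fourierFun (ħ : ℝ) (k : 𝓢(Dbl (Dbl W), ℂ)) (q : Dbl (Dbl W)) :
    symbolFun ħ υ hυ k q = fourierFun sympForm (2 * Module.finrank ℝ W) ħ
      (compCLMOfContinuousLinearEquiv ℂ (rearrange (W := W) υ hυ) k) q := by
  rw [symbolFun, fourierFun, fourierFun, ← integral_comp_rearrange υ hυ]
  simp only [sympFormTwo_rearrange]
  rfl

/-- Fourier inversion in $\xi$ turns the right-hand side into `weylFun` of $K=k\circ B$. Both sides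
then define the same tempered distribution, by the result for integrable kernels and Fubini. -/
theorem intertwiner_twoSidedConv_ae_eq (k : 𝓢(Dbl (Dbl W), ℂ))
    {D : L2 (Dbl W) →L[ℂ] L2 (Dbl W)} (hD : IsTwoSidedConv ħ k D) (u : 𝓢(Dbl W, ℂ)) :
    ∀ᵐ t : Dbl W, intertwiner W hħ hυ (D ((intertwiner W hħ hυ).symm (u.toLp 2))) t =
      ∫ r : Dbl W, (∫ ξ : Dbl W, symbolFun ħ υ hυ k (pt (t + r) ξ) *
        Complex.exp ((-(Real.pi * ħ * ⟪ξ, t - r⟫) : ℝ) * Complex.I)) * u r := by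
  let K : 𝓢(Dbl (Dbl W), ℂ) := compCLMOfContinuousLinearEquiv ℂ (rearrange (W := W) υ hυ) k
  have h1 : ∀ t r : Dbl W, ∫ ξ : Dbl W, symbolFun ħ υ hυ k (pt (t + r) ξ) *
      Complex.exp ((-(Real.pi * ħ * ⟪ξ, t - r⟫) : ℝ) * Complex.I) =
        partialSymbol ħ K (t + r) (t - r) := by
    intro t r
    simp only [symbolFun_eq_fourierFun]
    refine integral_fourierFun_sympForm_mul hħ ?_ (even_two_mul _) K _ _
    rw [finrank_dbl, two_mul]
  simp only [h1, ← weylFun_eq_integral]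
  refine ae_eq_of_toTemperedDistribution (locallyIntegrable_weylFun ħ K.integrable u) fun v => ?_
  rw [toTemperedDistribution_intertwiner_twoSidedConv hħ hυ k.integrable hD,
    ← integral_mul_coefficientRight hħ K.integrable]
  have h2 : integratedSchrodinger (W := Dbl W) hħ
      (rearrangeDist (W := W) hυ (integrableDist k.integrable)) u v =
    integrableDist k.integrable (compCLMOfContinuousLinearEquiv ℂ (rearrange (W := W) υ hυ).symm
      (coefficientRight hħ u v)) := rfl
  rw [h2, integrableDist_apply, ← integral_comp_rearrange υ hυ]
  congr 1
  ext q
  exact congrArg (fun z => K q * coefficientRight hħ u v z)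
    ((rearrange υ hυ).symm_apply_apply q)

end SchwartzKernel

end HeisConv

end

theorem mainTheorem1 (n : ℕ) (ħ υ : ℝ) (hħ : ħ ≠ 0) (hυ : υ ≠ 0) :
    ∃ (U : L2 (Dbl (R n)) ≃ₗᵢ[ℂ] L2 (Dbl (R n)))
      (US : 𝓢(Dbl (R n), ℂ) ≃L[ℂ] 𝓢(Dbl (R n), ℂ))
      (UT : 𝓢'(Dbl (R n), ℂ) ≃L[ℂ] 𝓢'(Dbl (R n), ℂ)),
      -- `US` and `UT` are the restriction and the extension of `U`
      (∀ u : 𝓢(Dbl (R n), ℂ), (US u).toLp 2 = U (u.toLp 2)) ∧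
      (∀ f : L2 (Dbl (R n)), UT (Lp.toTemperedDistribution f) = Lp.toTemperedDistribution (U f)) ∧
      -- `U` intertwines the two-sided representation with the Schrödinger representation
      (∀ (g : Heis (Dbl (R n))) (f : L2 (Dbl (R n))),
        schrodinger ħ g f = U (doubled ħ υ g (U.symm f))) ∧
      -- kernels that are tempered distributions
      (∀ k : 𝓢'(Dbl (Dbl (R n)), ℂ),
        ∃ D : 𝓢(Dbl (R n), ℂ) →L[ℂ] 𝓢'(Dbl (R n), ℂ),
          IsTwoSidedConvDist ħ k D ∧
          ∃ A : 𝓢(Dbl (R n), ℂ) →L[ℂ] 𝓢'(Dbl (R n), ℂ),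
            IsWeylPDO ħ hħ (symbolDist (W := R n) ħ υ hħ hυ k) A ∧
            ∀ u : 𝓢(Dbl (R n), ℂ), UT (D (US.symm u)) = A u) ∧
      -- integrable kernels, with bounded operators on `L²`
      (∀ k : Dbl (Dbl (R n)) → ℂ, Integrable k →
        ∃ D : L2 (Dbl (R n)) →L[ℂ] L2 (Dbl (R n)),
          IsTwoSidedConv ħ k D ∧
          ∃ (a : 𝓢'(Dbl (Dbl (R n)), ℂ)) (A : 𝓢(Dbl (R n), ℂ) →L[ℂ] 𝓢'(Dbl (R n), ℂ)),
            (∀ φ : 𝓢(Dbl (Dbl (R n)), ℂ), a φ = ∫ q, symbolFun ħ υ hυ k q * φ q) ∧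
            IsWeylPDO ħ hħ a A ∧
            ∀ u : 𝓢(Dbl (R n), ℂ),
              Lp.toTemperedDistribution (U (D (U.symm (u.toLp 2)))) = A u) ∧
      -- Schwartz kernels, with the Weyl operator written as an integral operator
      (∀ (k : 𝓢(Dbl (Dbl (R n)), ℂ)) (D : L2 (Dbl (R n)) →L[ℂ] L2 (Dbl (R n))),
        IsTwoSidedConv ħ k D →
        ∀ u : 𝓢(Dbl (R n), ℂ), ∀ᵐ t : Dbl (R n),
          U (D (U.symm (u.toLp 2))) t =
            ∫ r : Dbl (R n), (∫ ξ : Dbl (R n), symbolFun ħ υ hυ k (pt (t + r) ξ) *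
              Complex.exp ((-(Real.pi * ħ * inner ℝ ξ (t - r)) : ℝ) * Complex.I)) * u r) := by
  refine ⟨intertwiner (R n) hħ hυ, intertwinerSchwartz (R n) hħ hυ, intertwinerDist (R n) hħ hυ,
    fun u => (intertwiner_toLp hħ hυ u).symm, intertwinerDist_toTemperedDistribution hħ hυ,
    schrodinger_eq_intertwiner_doubled hħ hυ, fun k => ?_, fun k hk => ?_,
    fun k D hD u => intertwiner_twoSidedConv_ae_eq hħ hυ k hD u⟩
  · exact ⟨twoSidedConvDist hħ hυ k, isTwoSidedConvDist_twoSidedConvDist hħ hυ k,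
      integratedSchrodinger hħ (rearrangeDist hυ k), isWeylPDO_integratedSchrodinger hħ hυ k,
      intertwinerDist_twoSidedConvDist hħ hυ k⟩
  · obtain ⟨D, hD⟩ := exists_isTwoSidedConv hħ hk
    exact ⟨D, hD, symbolDist (W := R n) ħ υ hħ hυ (integrableDist hk),
      integratedSchrodinger hħ (rearrangeDist hυ (integrableDist hk)),
      symbolDist_integrableDist hħ hυ hk, isWeylPDO_integratedSchrodinger hħ hυ _,
      toTemperedDistribution_intertwiner_twoSidedConv hħ hυ hk hD⟩
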